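/- Let $n,r$ be positive integers and let $q$ be an indeterminate. For $a=(a_1,\dots,a_r)\in\{1,\dots,n\}^r$ let $w_a\in S_n$ be the permutation whose one-line notation is obtained from the sequence $(1,2,\dots,n,a_1,\dots,a_r)$ by keeping only the rightmost occurrence of each integer in $\{1,\dots,n\}$. For $w=(w_1,\dots,w_n)\in S_n$ let $\mathit{imaj}(w)$ be the sum of all $i\in\{1,\dots,n-1\}$ such that $i+1$ appears to the left of $i$ in $w$. Let $\Lambda_n^r$ be the set of partitions $\lambda=(\lambda_1,\dots,\lambda_t)$ of $n$ with $\lambda_2+\cdots+\lambda_t\le r$. A standard tableau $P$ of shape $\lambda\vdash n$ is a filling of the boxes of the Young diagram of $\lambda$ with $1,\dots,n$, each used once, increasing along rows (left to right) and down columns; $\mathrm{maj}(P)$ is the sum of all $i\in\{1,\dots,n-1\}$ such that $i+1$ is in a lower row of $P$ than $i$. An $r$-vacillating tableau of shape $\lambda$ is a sequence of partitions $((n)=\lambda^{(0)},\lambda^{(1/2)},\lambda^{(1)},\dots,\lambda^{(r)}=\lambda)$ such that, for $0\le i\le r-1$, the partition $\lambda^{(i+1/2)}$ of $n-1$ is obtained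 from $\lambda^{(i)}$ by deleting a box, and, for $1\le i\le r$, the partition $\lambda^{(i)}$ of $n$ is obtained from $\lambda^{(i-1/2)}$ by adding a box. Let $m^\lambda_r$ be the number of $r$-vacillating tableaux of shape $\lambda$, and let $f^\lambda_n(q)=\sum_T q^{\mathrm{maj}(T)}$, where $T$ ranges over all standard tableaux of shape $\lambda$. Then $$\sum_{a\in\{1,\dots,n\}^r} q^{\mathit{imaj}(w_a)}=\sum_{\lambda\in\Lambda_n^r}\ \sum_{(P,Q)} q^{\mathrm{maj}(P)}=\sum_{\lambda\in\Lambda_n^r} f^\lambda_n(q)\,m^\lambda_r,$$ where $(P,Q)$ ranges over all pairs consisting of a standard tableau $P$ of shape $\lambda$ and an $r$-vacillating tableau $Q$ of shape $\lambda$. -/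

import Mathlib

open Polynomial

namespace QPart

/-! ### Partitions, as Young diagrams -/

/-- The one-row partition `(n)`: the cells are `(0, 0), …, (0, n - 1)`. -/
def oneRow (n : ℕ) : YoungDiagram where
  cells := {0} ×ˢ Finset.range n
  isLowerSet := by
    rintro ⟨a, b⟩ ⟨c, d⟩ ⟨h1, h2⟩ h
    simp only [Finset.coe_product, Finset.coe_singleton, Finset.coe_range, Set.mem_prod,
      Set.mem_singleton_iff, Set.mem_Iio] at h ⊢
    simp only at h1 h2
    omega

/-- `AddBox μ ν` says that `ν` is obtained from `μ` by adding one box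
(equivalently, `μ` is obtained from `ν` by deleting one box). -/
def AddBox (μ ν : YoungDiagram) : Prop :=
  ∃ c, c ∉ μ.cells ∧ ν.cells = insert c μ.cells

/-- `Λ_n^r`: the partitions `(lam_1, …, lam_t)` of `n` with `lam_2 + ⋯ + lam_t ≤ r`. -/
def Lam (n r : ℕ) : Set YoungDiagram :=
  {μ | μ.card = n ∧ μ.rowLens.tail.sum ≤ r}

/-! ### Words and permutations -/

/-- `rightmost l` keeps exactly the rightmost occurrence of each letter of `l`
(this is what `List.dedup` does). -/
def rightmost {α : Type*} [DecidableEq α] (l : List α) : List α := l.dedup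

theorem rightmost_nodup {α : Type*} [DecidableEq α] (l : List α) : (rightmost l).Nodup :=
  List.nodup_dedup l

/-- The word `rightmost (1, 2, …, n, a_1, …, a_r)`.
An element `k : Fin n` stands for the letter `k + 1 ∈ {1, …, n}`. -/
def word {n r : ℕ} (a : Fin r → Fin n) : List (Fin n) :=
  rightmost (List.finRange n ++ List.ofFn a)

theorem mem_word {n r : ℕ} (a : Fin r → Fin n) (k : Fin n) : k ∈ word a := by
  simp [word, rightmost]

theorem word_length {n r : ℕ} (a : Fin r → Fin n) : (word a).length = n := by
  have h := Fintype.card_congr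
    (List.Nodup.getEquivOfForallMemList (word a) (rightmost_nodup _) (mem_word a))
  simpa using h

/-- The permutation `w_a`, sending a position to the letter of `word a` at that position
(positions and letters are both numbered from `0`). -/
def wordPerm {n r : ℕ} (a : Fin r → Fin n) : Equiv.Perm (Fin n) :=
  (finCongr (word_length a).symm).trans
    (List.Nodup.getEquivOfForallMemList (word a) (rightmost_nodup _) (mem_word a))

/-- The backsteps of `w = (w_1, …, w_n)`: those `i` such that `i + 1` is to the left of `i`.
Here `(w j : ℕ) + 1` is the letter in `{1, …, n}` at position `j`. -/
def backsteps {n : ℕ} (w : Equiv.Perm (Fin n)) : Finset ℕ :=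
  {i ∈ Finset.Icc 1 n | ∃ j k : Fin n, (w j : ℕ) + 1 = i + 1 ∧ (w k : ℕ) + 1 = i ∧ j < k}

/-- The inverse major index: the sum of the backsteps. -/
def imaj {n : ℕ} (w : Equiv.Perm (Fin n)) : ℕ := ∑ i ∈ backsteps w, i

/-! ### Standard tableaux -/

/-- A standard tableau of shape `μ`: a filling of the boxes with `1, …, |μ|`, each used once,
increasing along rows (left to right) and columns (top to bottom).
A cell `(i, j)` is in row `i` and column `j`; row `0` is the top row. -/
structure StandardTableau (μ : YoungDiagram) where
  entry : {c : ℕ × ℕ // c ∈ μ.cells} ≃ {k : ℕ // k ∈ Finset.Icc 1 μ.card}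
  row_lt : ∀ c d, c.1.1 = d.1.1 → c.1.2 < d.1.2 → (entry c).1 < (entry d).1
  col_lt : ∀ c d, c.1.2 = d.1.2 → c.1.1 < d.1.1 → (entry c).1 < (entry d).1

open scoped Classical in
/-- The descent set: those `i` such that `i + 1` is in a lower row than `i`. -/
noncomputable def StandardTableau.descents {μ : YoungDiagram} (P : StandardTableau μ) :
    Finset ℕ :=
  {i ∈ Finset.Icc 1 μ.card |
    ∃ c d, (P.entry c).1 = i ∧ (P.entry d).1 = i + 1 ∧ c.1.1 < d.1.1}

/-- The major index: the sum of the descents. -/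
noncomputable def StandardTableau.maj {μ : YoungDiagram} (P : StandardTableau μ) : ℕ :=
  ∑ i ∈ P.descents, i

/-! ### Vacillating tableaux -/

/-- An `r`-vacillating tableau of shape `μ` (starting from the partition `(n)`): a sequence
`lam^(0), lam^(1/2), lam^(1), …, lam^(r)` of partitions with `lam^(0) = (n)` and `lam^(r) = μ` in
which one alternately deletes a box and adds a box.
`full i` is `lam^(i)` and `half i` is `lam^(i + 1/2)`. -/
structure VacillatingTableau (n r : ℕ) (μ : YoungDiagram) where
  full : Fin (r + 1) → YoungDiagram
  half : Fin r → YoungDiagram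
  full_zero : full 0 = oneRow n
  del_box : ∀ i : Fin r, AddBox (half i) (full i.castSucc)
  add_box : ∀ i : Fin r, AddBox (half i) (full i.succ)
  full_last : full (Fin.last r) = μ

/-! ### Finiteness -/

theorem AddBox.card_eq {μ ν : YoungDiagram} (h : AddBox μ ν) : ν.card = μ.card + 1 := by
  obtain ⟨c, hc, h⟩ := h
  rw [YoungDiagram.card, h, Finset.card_insert_of_notMem hc]

theorem card_oneRow (n : ℕ) : (oneRow n).card = n := by
  simp [YoungDiagram.card, oneRow]

theorem cells_subset_of_card_le {μ : YoungDiagram} {n : ℕ} (h : μ.card ≤ n) :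
    μ.cells ⊆ Finset.range n ×ˢ Finset.range n := by
  rintro ⟨i, j⟩ hc
  rw [YoungDiagram.mem_cells] at hc
  have h1 : i < μ.colLen j := YoungDiagram.mem_iff_lt_colLen.1 hc
  have h2 : j < μ.rowLen i := YoungDiagram.mem_iff_lt_rowLen.1 hc
  have h3 : μ.colLen j ≤ μ.card := by
    rw [YoungDiagram.colLen_eq_card]
    exact Finset.card_le_card (Finset.filter_subset _ _)
  have h4 : μ.rowLen i ≤ μ.card := by
    rw [YoungDiagram.rowLen_eq_card]
    exact Finset.card_le_card (Finset.filter_subset _ _)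
  simp only [Finset.mem_product, Finset.mem_range]
  omega

theorem finite_card_le (n : ℕ) : {μ : YoungDiagram | μ.card ≤ n}.Finite := by
  have h : (((Finset.range n ×ˢ Finset.range n).powerset : Finset _) :
      Set (Finset (ℕ × ℕ))).Finite := Finset.finite_toSet _
  refine Set.Finite.of_injOn (f := YoungDiagram.cells) ?_ ?_ h
  · intro μ hμ
    exact Finset.mem_coe.2 (Finset.mem_powerset.2 (cells_subset_of_card_le hμ))
  · intro μ _ ν _ e
    exact YoungDiagram.ext e

theorem finite_Lam (n r : ℕ) : (Lam n r).Finite :=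
  (finite_card_le n).subset fun _ h => le_of_eq h.1

theorem VacillatingTableau.card_full {n r : ℕ} {μ : YoungDiagram}
    (Q : VacillatingTableau n r μ) (i : Fin (r + 1)) : (Q.full i).card = n := by
  induction i using Fin.induction with
  | zero => rw [Q.full_zero, card_oneRow]
  | succ i ih =>
    have h1 := (Q.del_box i).card_eq
    have h2 := (Q.add_box i).card_eq
    omega

theorem VacillatingTableau.card_half {n r : ℕ} {μ : YoungDiagram}
    (Q : VacillatingTableau n r μ) (i : Fin r) : (Q.half i).card + 1 = n := by
  rw [← (Q.del_box i).card_eq, Q.card_full]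

theorem finite_vacillatingTableau (n r : ℕ) (μ : YoungDiagram) :
    Finite (VacillatingTableau n r μ) := by
  have : Finite {μ : YoungDiagram // μ.card ≤ n} := (finite_card_le n).to_subtype
  refine Finite.of_injective
    (β := (Fin (r + 1) → {μ : YoungDiagram // μ.card ≤ n}) ×
      (Fin r → {μ : YoungDiagram // μ.card ≤ n}))
    (fun Q => (fun i => ⟨Q.full i, (Q.card_full i).le⟩,
      fun i => ⟨Q.half i, by have := Q.card_half i; omega⟩)) ?_
  rintro ⟨f, g, _, _, _, _⟩ ⟨f', g', _, _, _, _⟩ h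
  simp only [Prod.mk.injEq, funext_iff, Subtype.mk.injEq] at h
  obtain rfl : f = f' := funext h.1
  obtain rfl : g = g' := funext h.2
  rfl

theorem finite_standardTableau (μ : YoungDiagram) : Finite (StandardTableau μ) := by
  refine Finite.of_injective (fun P => P.entry) ?_
  rintro ⟨e, _, _⟩ ⟨e', _, _⟩ h
  obtain rfl : e = e' := h
  rfl

noncomputable instance (n r : ℕ) : Fintype (Lam n r) := (finite_Lam n r).fintype

noncomputable instance (μ : YoungDiagram) : Fintype (StandardTableau μ) :=
  @Fintype.ofFinite _ (finite_standardTableau μ)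

noncomputable instance (n r : ℕ) (μ : YoungDiagram) : Fintype (VacillatingTableau n r μ) :=
  @Fintype.ofFinite _ (finite_vacillatingTableau n r μ)

/-! ### The numbers in the identity -/

/-- `f^μ(q) = ∑_T q^{maj T}`, the sum over all standard tableaux `T` of shape `μ`. -/
noncomputable def fq (μ : YoungDiagram) : ℤ[X] := ∑ T : StandardTableau μ, X ^ T.maj

/-- `m^μ_r`, the number of `r`-vacillating tableaux of shape `μ` (starting from `(n)`). -/
noncomputable def numVac (n r : ℕ) (μ : YoungDiagram) : ℕ :=
  Fintype.card (VacillatingTableau n r μ)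

end QPart

namespace QPart

/-! ### Row lengths -/

/-! More is true: the backstep set of `wordPerm a` and the descent set of `P` are equidistributed.
It is enough to count, for every finite `S`, the objects whose set is contained in `S`; strong
induction on `S` then recovers the objects whose set equals `S`.

Elements of `S` cut `1, …, n` into blocks. A standard tableau has all its descents in `S` iff,
within each block, successive entries move weakly upwards, so each block fills a horizontal strip.
Hence the tableaux of shape `ν` with descents in `S` are counted by the Kostka-type number `chains S
n ν` (`card_descents_subset`), and the pairs by `∑ ν, numVac n r ν * chains S n ν`.

Both counts satisfy the same recursion in `r`. Appending a letter `v` to a word moves `v` to the end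
of the permutation. The new backsteps lie in `S` iff `v` ends a block and the old ones lie in `S ∪
{v - 1}` (`wordCount_succ`). On the other side, deleting and adding a box is a symmetric operator
`vac`, so it can be moved from `numVac` onto `chains`. There `vac_chains` produces the same sum over
block ends: a block of size `m` is split into `m - 1` and `1`. This is the action of `h₁ · h₁^⊥` on
a product of complete symmetric functions, obtained from the commutation of adding and deleting
boxes with deleting horizontal strips (`card_up_strip`, `card_down_strip`). For `r = 0` both counts
are `1` (`wordCount_eq`). -/

theorem ext_rowLen {μ ν : YoungDiagram} (h : ∀ i, μ.rowLen i = ν.rowLen i) : μ = ν := by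
  apply YoungDiagram.ext
  ext ⟨i, j⟩
  rw [YoungDiagram.mem_cells, YoungDiagram.mem_cells, YoungDiagram.mem_iff_lt_rowLen,
    YoungDiagram.mem_iff_lt_rowLen, h]

theorem rowLen_succ_le (μ : YoungDiagram) (i : ℕ) : μ.rowLen (i + 1) ≤ μ.rowLen i :=
  μ.rowLen_anti _ _ (Nat.le_succ i)

theorem exists_rowLen_eq {f : ℕ → ℕ} (hf : ∀ i, f (i + 1) ≤ f i) {N : ℕ} (hN : f N = 0) :
    ∃ μ : YoungDiagram, ∀ i, μ.rowLen i = f i := by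
  have hanti : Antitone f := antitone_nat_of_succ_le hf
  let μ : YoungDiagram :=
    { cells := (Finset.range N ×ˢ Finset.range (f 0)).filter (fun c => c.2 < f c.1)
      isLowerSet := by
        rintro ⟨a, b⟩ ⟨c, d⟩ ⟨h1, h2⟩ h
        simp only [Finset.coe_filter, Finset.mem_product, Finset.mem_range, Set.mem_ofPred_eq]
          at h ⊢
        simp only at h1 h2
        have := hanti h1
        omega }
  have hmem : ∀ i j, (i, j) ∈ μ ↔ j < f i := by
    intro i j
    rw [← YoungDiagram.mem_cells]
    simp only [μ, Finset.mem_filter, Finset.mem_product, Finset.mem_range]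
    refine ⟨fun h => h.2, fun h => ⟨⟨?_, h.trans_le (hanti (Nat.zero_le i))⟩, h⟩⟩
    by_contra hi
    have := hanti (not_lt.1 hi)
    omega
  refine ⟨μ, fun i => ?_⟩
  refine le_antisymm ?_ ?_
  · by_contra h
    exact lt_irrefl _ ((hmem i (f i)).1 (YoungDiagram.mem_iff_lt_rowLen.2 (not_le.1 h)))
  · by_contra h
    exact lt_irrefl _ (YoungDiagram.mem_iff_lt_rowLen.1 ((hmem i _).2 (not_le.1 h)))

theorem exists_rowLen_eq_zero (μ : YoungDiagram) : ∃ N, μ.rowLen N = 0 := by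
  refine ⟨μ.colLen 0, ?_⟩
  by_contra h
  exact lt_irrefl _ (YoungDiagram.mem_iff_lt_colLen.1
    (YoungDiagram.mem_iff_lt_rowLen.2 (Nat.pos_of_ne_zero h)))

theorem le_iff_rowLen {μ ν : YoungDiagram} : μ ≤ ν ↔ ∀ i, μ.rowLen i ≤ ν.rowLen i := by
  rw [← YoungDiagram.cells_subset_iff]
  constructor
  · intro h i
    by_contra hi
    have h1 := h ((YoungDiagram.mem_cells _).2 (YoungDiagram.mem_iff_lt_rowLen.2 (not_le.1 hi)))
    exact lt_irrefl _ (YoungDiagram.mem_iff_lt_rowLen.1 ((YoungDiagram.mem_cells _).1 h1))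
  · rintro h ⟨i, j⟩ hc
    rw [YoungDiagram.mem_cells, YoungDiagram.mem_iff_lt_rowLen] at hc ⊢
    exact hc.trans_le (h i)

/-- `ν` is obtained from `μ` by adding a box at the end of row `i`. -/
def AddRow (μ : YoungDiagram) (i : ℕ) (ν : YoungDiagram) : Prop :=
  ν.rowLen i = μ.rowLen i + 1 ∧ ∀ k, k ≠ i → ν.rowLen k = μ.rowLen k

theorem AddRow.cells_eq {μ ν : YoungDiagram} {i : ℕ} (h : AddRow μ i ν) :
    ν.cells = insert (i, μ.rowLen i) μ.cells := by
  ext ⟨a, b⟩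
  rw [Finset.mem_insert, YoungDiagram.mem_cells, YoungDiagram.mem_cells,
    YoungDiagram.mem_iff_lt_rowLen, YoungDiagram.mem_iff_lt_rowLen, Prod.mk.injEq]
  by_cases ha : a = i
  · subst ha
    rw [h.1]
    omega
  · rw [h.2 a ha]
    omega

theorem AddRow.notMem {μ ν : YoungDiagram} {i : ℕ} (_h : AddRow μ i ν) :
    (i, μ.rowLen i) ∉ μ.cells := by
  rw [YoungDiagram.mem_cells, YoungDiagram.mem_iff_lt_rowLen]
  exact lt_irrefl _

theorem AddRow.addBox {μ ν : YoungDiagram} {i : ℕ} (h : AddRow μ i ν) : AddBox μ ν :=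
  ⟨_, h.notMem, h.cells_eq⟩

/-- The new cell must be the first one missing from its row: otherwise `ν`, being a lower set, would
contain an earlier missing cell as well. -/
theorem addRow_of_cells_eq {μ ν : YoungDiagram} {c : ℕ × ℕ} (hc : c ∉ μ.cells)
    (h : ν.cells = insert c μ.cells) : c.2 = μ.rowLen c.1 ∧ AddRow μ c.1 ν := by
  obtain ⟨i, j⟩ := c
  have key : ∀ a b, b < ν.rowLen a ↔ (a = i ∧ b = j) ∨ b < μ.rowLen a := by
    intro a b
    rw [← YoungDiagram.mem_iff_lt_rowLen, ← YoungDiagram.mem_cells, h, Finset.mem_insert,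
      YoungDiagram.mem_cells, YoungDiagram.mem_iff_lt_rowLen, Prod.mk.injEq]
  rw [YoungDiagram.mem_cells, YoungDiagram.mem_iff_lt_rowLen] at hc
  have hj : j < ν.rowLen i := (key i j).2 (Or.inl ⟨rfl, rfl⟩)
  have hj' : j = μ.rowLen i := by
    by_contra hne
    have h1 := (key i (μ.rowLen i)).1 (by omega)
    omega
  refine ⟨hj', ?_, fun k hk => ?_⟩
  · have h1 := key i (μ.rowLen i + 1)
    simp only
    omega
  · have h1 := key k (μ.rowLen k)
    have h2 := key k (ν.rowLen k)
    simp only at hk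
    omega

theorem addBox_iff {μ ν : YoungDiagram} : AddBox μ ν ↔ ∃ i, AddRow μ i ν :=
  ⟨fun ⟨c, hc, h⟩ => ⟨c.1, (addRow_of_cells_eq hc h).2⟩, fun ⟨_, h⟩ => h.addBox⟩

theorem AddRow.index_unique {μ ν : YoungDiagram} {i j : ℕ} (h : AddRow μ i ν)
    (h' : AddRow μ j ν) : i = j := by
  by_contra hne
  have h1 := h'.2 i hne
  have h2 := h.1
  omega

theorem AddRow.right_unique {μ ν ν' : YoungDiagram} {i : ℕ} (h : AddRow μ i ν)
    (h' : AddRow μ i ν') : ν = ν' := by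
  apply ext_rowLen
  intro k
  by_cases hk : k = i
  · subst hk
    rw [h.1, h'.1]
  · rw [h.2 k hk, h'.2 k hk]

theorem AddRow.left_unique {μ μ' ν : YoungDiagram} {i : ℕ} (h : AddRow μ i ν)
    (h' : AddRow μ' i ν) : μ = μ' := by
  apply ext_rowLen
  intro k
  by_cases hk : k = i
  · subst hk
    have h1 := h.1
    have h2 := h'.1
    omega
  · rw [← h.2 k hk, ← h'.2 k hk]

/-- The hypothesis concerns the row just above row `i`, and is vacuous for `i = 0`. -/
theorem exists_addRow {μ : YoungDiagram} {i : ℕ}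
    (h : ∀ k, k + 1 = i → μ.rowLen i < μ.rowLen k) : ∃ ν, AddRow μ i ν := by
  obtain ⟨N, hN⟩ := exists_rowLen_eq_zero μ
  -- Row `N + i + 1` lies beyond the diagram and beyond row `i`, so the modified row lengths vanish
  -- there too.
  have hN' : μ.rowLen (N + i + 1) = 0 :=
    Nat.le_zero.1 ((μ.rowLen_anti N (N + i + 1) (by omega)).trans hN.le)
  obtain ⟨ν, hν⟩ := exists_rowLen_eq (f := fun k => μ.rowLen k + if k = i then 1 else 0)
    (N := N + i + 1) (by
      intro k
      have h1 := rowLen_succ_le μ k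
      have h2 := h k
      by_cases hk : k + 1 = i
      · subst hk
        have := h2 rfl
        simp
        omega
      · simp [hk]
        omega) (by
      simp only [hN', Nat.zero_add, ite_eq_right_iff]
      omega)
  refine ⟨ν, ?_, fun k hk => ?_⟩
  · rw [hν]; simp
  · rw [hν]; simp [hk]

theorem exists_removeRow {ν : YoungDiagram} {i : ℕ} (h : ν.rowLen (i + 1) < ν.rowLen i) :
    ∃ μ, AddRow μ i ν := by
  obtain ⟨N, hN⟩ := exists_rowLen_eq_zero ν
  obtain ⟨μ, hμ⟩ := exists_rowLen_eq (f := fun k => ν.rowLen k - if k = i then 1 else 0)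
    (N := N) (by
      intro k
      have h1 := rowLen_succ_le ν k
      by_cases hk : k = i
      · subst hk
        simp
        omega
      · simp only [hk, if_false]
        split_ifs <;> omega) (by
      simp [hN])
  refine ⟨μ, ?_, fun k hk => ?_⟩
  · rw [hμ]; simp; omega
  · rw [hμ]; simp [hk]

/-! ### Horizontal strips -/

/-- `Strip μ ν` says that `ν / μ` is a horizontal strip. -/
def Strip (μ ν : YoungDiagram) : Prop :=
  ∀ i, μ.rowLen i ≤ ν.rowLen i ∧ ν.rowLen (i + 1) ≤ μ.rowLen i

theorem Strip.refl (μ : YoungDiagram) : Strip μ μ := fun i => ⟨le_rfl, rowLen_succ_le μ i⟩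

theorem Strip.le {μ ν : YoungDiagram} (h : Strip μ ν) : μ ≤ ν :=
  le_iff_rowLen.2 fun i => (h i).1

theorem card_le_of_le {μ ν : YoungDiagram} (h : μ ≤ ν) : μ.card ≤ ν.card :=
  Finset.card_le_card (YoungDiagram.cells_subset_iff.2 h)

theorem eq_of_le_of_card_le {μ ν : YoungDiagram} (h : μ ≤ ν) (hc : ν.card ≤ μ.card) : μ = ν :=
  YoungDiagram.ext (Finset.eq_of_subset_of_card_le (YoungDiagram.cells_subset_iff.2 h) hc)

theorem AddRow.strip {μ ν : YoungDiagram} {i : ℕ} (h : AddRow μ i ν) : Strip μ ν := by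
  intro k
  have h1 := rowLen_succ_le μ k
  have h2 := rowLen_succ_le ν k
  have h3 := h.1
  have h4 := h.2 k
  have h5 := h.2 (k + 1)
  by_cases hk : k = i
  · subst hk
    have := h5 (by omega)
    omega
  · have := h4 hk
    omega

theorem addBox_of_le_of_card {μ ν : YoungDiagram} (h : μ ≤ ν) (hc : ν.card = μ.card + 1) :
    AddBox μ ν := by
  have hs := YoungDiagram.cells_subset_iff.2 h
  have h1 : (ν.cells \ μ.cells).card = 1 := by
    rw [Finset.card_sdiff_of_subset hs]
    simp only [YoungDiagram.card] at hc
    omega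
  obtain ⟨c, hc⟩ := Finset.card_eq_one.1 h1
  refine ⟨c, (Finset.mem_sdiff.1 (hc ▸ Finset.mem_singleton_self c)).2, ?_⟩
  rw [Finset.insert_eq, ← hc, Finset.sdiff_union_of_subset hs]

theorem strip_and_card_iff_addBox {μ ν : YoungDiagram} :
    Strip μ ν ∧ ν.card = μ.card + 1 ↔ AddBox μ ν := by
  constructor
  · rintro ⟨h, hc⟩
    exact addBox_of_le_of_card h.le hc
  · intro h
    obtain ⟨i, hi⟩ := addBox_iff.1 h
    exact ⟨hi.strip, h.card_eq⟩

/-! ### Finite sets of diagrams -/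

theorem finite_of_card_le {p : YoungDiagram → Prop} (n : ℕ) (h : ∀ μ, p μ → μ.card ≤ n) :
    {μ | p μ}.Finite :=
  (finite_card_le n).subset h

/-- The partitions of `n`. -/
noncomputable def parts (n : ℕ) : Finset YoungDiagram :=
  (finite_of_card_le (p := fun μ => μ.card = n) n fun _ h => h.le).toFinset

/-- The diagrams obtained by deleting a box. -/
noncomputable def down (ν : YoungDiagram) : Finset YoungDiagram :=
  (finite_of_card_le (p := fun μ => AddBox μ ν) ν.card
    fun _ h => (Nat.le_succ _).trans h.card_eq.ge).toFinset

/-- The diagrams obtained by adding a box. -/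
noncomputable def up (μ : YoungDiagram) : Finset YoungDiagram :=
  (finite_of_card_le (p := fun ν => AddBox μ ν) (μ.card + 1) fun _ h => h.card_eq.le).toFinset

/-- The diagrams obtained by deleting a horizontal strip. -/
noncomputable def strips (ν : YoungDiagram) : Finset YoungDiagram :=
  (finite_of_card_le (p := fun μ => Strip μ ν) ν.card fun _ h => card_le_of_le h.le).toFinset

@[simp] theorem mem_parts {n : ℕ} {μ : YoungDiagram} : μ ∈ parts n ↔ μ.card = n := by
  simp [parts]

@[simp] theorem mem_down {μ ν : YoungDiagram} : μ ∈ down ν ↔ AddBox μ ν := by simp [down]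

@[simp] theorem mem_up {μ ν : YoungDiagram} : ν ∈ up μ ↔ AddBox μ ν := by simp [up]

@[simp] theorem mem_strips {μ ν : YoungDiagram} : μ ∈ strips ν ↔ Strip μ ν := by simp [strips]

/-! ### Commutation of adding or deleting boxes with deleting horizontal strips -/

theorem AddRow.zero_strip {μ ν ν' : YoungDiagram} (h : AddRow ν 0 ν') (hs : Strip μ ν) :
    Strip μ ν' := by
  intro k
  have h1 := hs k
  have h2 := h.2 (k + 1) (by omega)
  rcases Nat.eq_zero_or_pos k with rfl | hk
  · have := h.1
    omega
  · have := h.2 k (by omega)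
    omega

/-- For a strip `ν / μ`, adding a box to `ν` in row `j + 1` and deleting one from `μ` in row `j`
both keep a strip iff `ν.rowLen (j + 1) < μ.rowLen j`. This and the next lemma are the two
directions. -/
theorem exists_addRow_strip {μ ν κ : YoungDiagram} {j : ℕ} (hs : Strip μ ν)
    (hκ : AddRow κ j μ) (hκs : Strip κ ν) : ∃ ν', AddRow ν (j + 1) ν' ∧ Strip μ ν' := by
  have h1 := hκ.1
  have h2 := hκs j
  obtain ⟨ν', h⟩ := exists_addRow (μ := ν) (i := j + 1) (by
    intro k hk
    obtain rfl : k = j := by omega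
    have := hs k
    omega)
  refine ⟨ν', h, fun k => ?_⟩
  have h3 := hs k
  have h4 := h.1
  have h5 := h.2 k
  have h6 := h.2 (k + 1)
  grind

theorem exists_removeRow_strip {μ ν ν' : YoungDiagram} {j : ℕ} (hs : Strip μ ν)
    (h : AddRow ν (j + 1) ν') (hs' : Strip μ ν') : ∃ κ, AddRow κ j μ ∧ Strip κ ν := by
  have h1 := h.1
  have h2 := hs' j
  obtain ⟨κ, hκ⟩ := exists_removeRow (ν := μ) (i := j) (by
    have := hs (j + 1)
    omega)
  refine ⟨κ, hκ, fun k => ?_⟩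
  have h3 := hs k
  have h4 := hκ.1
  have h5 := hκ.2 k
  grind

/-- A box added to `ν` in row `i` can only repair the inequality `μ.rowLen i ≤ ν.rowLen i`, so that
is the only one that fails, and it fails by one. Deleting a box from `μ` can only repair the same
inequality. -/
theorem rowLen_eq_of_addRow_strip {μ ν ν' : YoungDiagram} {i : ℕ} (hs : ¬ Strip μ ν)
    (h : AddRow ν i ν') (hs' : Strip μ ν') : μ.rowLen i = ν.rowLen i + 1 := by
  by_contra hne
  refine hs fun k => ?_
  have h1 := hs' k
  have h2 := h.1
  have h3 := h.2 k
  have h4 := h.2 (k + 1)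
  grind

theorem rowLen_eq_of_removeRow_strip {μ ν κ : YoungDiagram} {i : ℕ} (hs : ¬ Strip μ ν)
    (h : AddRow κ i μ) (hs' : Strip κ ν) : μ.rowLen i = ν.rowLen i + 1 := by
  by_contra hne
  refine hs fun k => ?_
  have h1 := hs' k
  have h2 := h.1
  have h3 := h.2 k
  grind

theorem exists_addRow_of_not_strip {μ ν κ : YoungDiagram} {i : ℕ} (hs : ¬ Strip μ ν)
    (h : AddRow κ i μ) (hs' : Strip κ ν) : ∃ ν', AddRow ν i ν' ∧ Strip μ ν' := by
  have h0 := rowLen_eq_of_removeRow_strip hs h hs'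
  obtain ⟨ν', hν⟩ := exists_addRow (μ := ν) (i := i) (by
    intro k hk
    have h1 := hs' k
    have h2 := h.2 k (by omega)
    have h3 := rowLen_succ_le μ k
    subst hk
    omega)
  refine ⟨ν', hν, fun k => ?_⟩
  have h1 := hs' k
  have h2 := h.1
  have h3 := h.2 k
  have h4 := hν.1
  have h5 := hν.2 k
  have h6 := hν.2 (k + 1)
  have h7 := rowLen_succ_le μ k
  grind

theorem exists_removeRow_of_not_strip {μ ν ν' : YoungDiagram} {i : ℕ} (hs : ¬ Strip μ ν)
    (h : AddRow ν i ν') (hs' : Strip μ ν') : ∃ κ, AddRow κ i μ ∧ Strip κ ν := by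
  have h0 := rowLen_eq_of_addRow_strip hs h hs'
  obtain ⟨κ, hκ⟩ := exists_removeRow (ν := μ) (i := i) (by
    have h1 := hs' (i + 1)
    have h2 := h.2 (i + 1) (by omega)
    have h3 := rowLen_succ_le ν i
    omega)
  refine ⟨κ, hκ, fun k => ?_⟩
  have h1 := hs' k
  have h2 := h.1
  have h3 := h.2 k
  have h4 := hκ.1
  have h5 := hκ.2 k
  have h6 := h.2 (k + 1)
  have h7 := rowLen_succ_le ν k
  grind

open scoped Classical in
-- A relation that is total and single-valued in both directions is the graph of a bijection.
theorem card_eq_of_relation {s t : Finset YoungDiagram} (r : YoungDiagram → YoungDiagram → Prop)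
    (hs : ∀ a ∈ s, ∃ b ∈ t, r a b) (ht : ∀ b ∈ t, ∃ a ∈ s, r a b)
    (hl : ∀ a a' b, r a b → r a' b → a = a') (hr : ∀ a b b', r a b → r a b' → b = b') :
    s.card = t.card :=
  le_antisymm
    (Finset.card_le_card_of_forall_subsingleton r hs fun b _ a ha a' ha' =>
      hl a a' b ha.2 ha'.2)
    (Finset.card_le_card_of_forall_subsingleton' r ht fun a _ b hb b' hb' =>
      hr a b b' hb.2 hb'.2)

open scoped Classical in
-- If `ν / μ` is a strip, a box can always be added to `ν` in row `0`, which gives the extra `1`;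
-- additions in row `j + 1` match deletions from `μ` in row `j`. If it is not a strip, both sides
-- must repair the same violated inequality, and additions match deletions in the same row.
theorem card_up_strip (μ ν : YoungDiagram) :
    {ν' ∈ up ν | Strip μ ν'}.card =
      {κ ∈ down μ | Strip κ ν}.card + if Strip μ ν then 1 else 0 := by
  by_cases hs : Strip μ ν
  · obtain ⟨ν₀, h₀⟩ := exists_addRow (μ := ν) (i := 0) (by omega)
    have hmem : ν₀ ∈ {ν' ∈ up ν | Strip μ ν'} := by
      simp only [Finset.mem_filter, mem_up]
      exact ⟨h₀.addBox, h₀.zero_strip hs⟩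
    rw [if_pos hs, ← Finset.card_erase_add_one hmem]
    congr 1
    refine card_eq_of_relation (fun ν' κ => ∃ j, AddRow ν (j + 1) ν' ∧ AddRow κ j μ) ?_ ?_ ?_ ?_
    · intro ν' h
      simp only [Finset.mem_erase, Finset.mem_filter, mem_up, addBox_iff] at h
      obtain ⟨hne, ⟨i, hi⟩, hs'⟩ := h
      cases i with
      | zero => exact absurd (hi.right_unique h₀) hne
      | succ j =>
        obtain ⟨κ, hκ, hκs⟩ := exists_removeRow_strip hs hi hs'
        exact ⟨κ, by simp [hκ.addBox, hκs], j, hi, hκ⟩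
    · intro κ h
      simp only [Finset.mem_filter, mem_down, addBox_iff] at h
      obtain ⟨⟨j, hj⟩, hκs⟩ := h
      obtain ⟨ν', h, hs'⟩ := exists_addRow_strip hs hj hκs
      refine ⟨ν', ?_, j, h, hj⟩
      simp only [Finset.mem_erase, Finset.mem_filter, mem_up]
      refine ⟨?_, h.addBox, hs'⟩
      rintro rfl
      exact absurd (h.index_unique h₀) (by omega)
    · rintro a a' b ⟨j, h1, h2⟩ ⟨j', h1', h2'⟩
      obtain rfl := h2.index_unique h2'
      exact h1.right_unique h1'
    · rintro a b b' ⟨j, h1, h2⟩ ⟨j', h1', h2'⟩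
      obtain rfl : j = j' := by have := h1.index_unique h1'; omega
      exact h2.left_unique h2'
  · rw [if_neg hs, add_zero]
    refine card_eq_of_relation (fun ν' κ => ∃ j, AddRow ν j ν' ∧ AddRow κ j μ) ?_ ?_ ?_ ?_
    · intro ν' h
      simp only [Finset.mem_filter, mem_up, addBox_iff] at h
      obtain ⟨⟨i, hi⟩, hs'⟩ := h
      obtain ⟨κ, hκ, hκs⟩ := exists_removeRow_of_not_strip hs hi hs'
      exact ⟨κ, by simp [hκ.addBox, hκs], i, hi, hκ⟩
    · intro κ h
      simp only [Finset.mem_filter, mem_down, addBox_iff] at h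
      obtain ⟨⟨j, hj⟩, hκs⟩ := h
      obtain ⟨ν', h, hs'⟩ := exists_addRow_of_not_strip hs hj hκs
      exact ⟨ν', by simp [h.addBox, hs'], j, h, hj⟩
    · rintro a a' b ⟨j, h1, h2⟩ ⟨j', h1', h2'⟩
      obtain rfl := h2.index_unique h2'
      exact h1.right_unique h1'
    · rintro a b b' ⟨j, h1, h2⟩ ⟨j', h1', h2'⟩
      obtain rfl := h1.index_unique h1'
      exact h2.left_unique h2'

theorem exists_add_remove_of_strip {μ ν : YoungDiagram} {i : ℕ} (hs : Strip μ ν)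
    (h : μ.rowLen i < ν.rowLen i) :
    (∃ μ', AddRow μ i μ' ∧ Strip μ' ν) ∧ ∃ ν', AddRow ν' i ν ∧ Strip μ ν' := by
  obtain ⟨μ', hμ⟩ := exists_addRow (μ := μ) (i := i) (by
    rintro k rfl
    have := hs k
    omega)
  obtain ⟨ν', hν⟩ := exists_removeRow (ν := ν) (i := i) (by
    have := hs i
    omega)
  refine ⟨⟨μ', hμ, fun k => ?_⟩, ν', hν, fun k => ?_⟩
  · have h1 := hs k
    have h2 := hμ.1
    have h3 := hμ.2 k
    grind
  · have h1 := hs k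
    have h2 := hν.1
    have h3 := hν.2 k
    have h4 := hν.2 (k + 1)
    grind

/-- Here the inequality to be repaired is `ν.rowLen (i + 1) ≤ μ.rowLen i`. It can be repaired by
adding to `μ` in row `i`, or by deleting from `ν` in row `i + 1`. -/
theorem rowLen_eq_of_addRow_left {μ μ' ν : YoungDiagram} {i : ℕ} (hs : ¬ Strip μ ν)
    (h : AddRow μ i μ') (hs' : Strip μ' ν) : ν.rowLen (i + 1) = μ.rowLen i + 1 := by
  by_contra hne
  refine hs fun k => ?_
  have h1 := hs' k
  have h2 := h.1
  have h3 := h.2 k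
  grind

theorem exists_eq_succ_of_removeRow {μ ν ν' : YoungDiagram} {i : ℕ} (hs : ¬ Strip μ ν)
    (h : AddRow ν' i ν) (hs' : Strip μ ν') :
    ∃ j, i = j + 1 ∧ ν.rowLen (j + 1) = μ.rowLen j + 1 := by
  by_contra hne
  push Not at hne
  refine hs fun k => ?_
  have h1 := hs' k
  have h2 := h.1
  have h3 := h.2 k
  have h4 := h.2 (k + 1)
  have h5 := hne k
  grind

theorem exists_removeRow_right_of_not_strip {μ μ' ν : YoungDiagram} {i : ℕ} (hs : ¬ Strip μ ν)
    (h : AddRow μ i μ') (hs' : Strip μ' ν) : ∃ ν', AddRow ν' (i + 1) ν ∧ Strip μ ν' := by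
  have h0 := rowLen_eq_of_addRow_left hs h hs'
  obtain ⟨ν', hν⟩ := exists_removeRow (ν := ν) (i := i + 1) (by
    have h1 := hs' (i + 1)
    have h2 := h.2 (i + 1) (by omega)
    have h3 := rowLen_succ_le μ i
    omega)
  refine ⟨ν', hν, fun k => ?_⟩
  have h1 := hs' k
  have h2 := h.1
  have h3 := h.2 k
  have h4 := hν.1
  have h5 := hν.2 k
  have h6 := hν.2 (k + 1)
  have h7 := rowLen_succ_le μ i
  grind

theorem exists_addRow_left_of_not_strip {μ ν ν' : YoungDiagram} {i : ℕ} (hs : ¬ Strip μ ν)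
    (h : AddRow ν' (i + 1) ν) (hs' : Strip μ ν') : ∃ μ', AddRow μ i μ' ∧ Strip μ' ν := by
  obtain ⟨_, hj, h0⟩ := exists_eq_succ_of_removeRow hs h hs'
  obtain rfl := Nat.succ_injective hj
  obtain ⟨μ', hμ⟩ := exists_addRow (μ := μ) (i := i) (by
    rintro k rfl
    have h1 := hs' k
    have h2 := h.2 (k + 1) (by omega)
    have h3 := rowLen_succ_le ν (k + 1)
    omega)
  refine ⟨μ', hμ, fun k => ?_⟩
  have h1 := hs' k
  have h2 := h.1
  have h3 := h.2 k
  have h4 := hμ.1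
  have h5 := hμ.2 k
  have h6 := h.2 (k + 1)
  have h7 := rowLen_succ_le ν i
  grind

open scoped Classical in
-- If `ν / μ` is a strip, deleting from `ν` in row `i` and adding to `μ` in row `i` are both
-- possible iff the strip has a box in row `i`. Otherwise the repair pairs row `i + 1` of `ν` with
-- row `i` of `μ`.
theorem card_down_strip (μ ν : YoungDiagram) :
    {ν' ∈ down ν | Strip μ ν'}.card = {μ' ∈ up μ | Strip μ' ν}.card := by
  by_cases hs : Strip μ ν
  · refine card_eq_of_relation (fun ν' μ' => ∃ j, AddRow ν' j ν ∧ AddRow μ j μ') ?_ ?_ ?_ ?_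
    · intro ν' h
      simp only [Finset.mem_filter, mem_down, addBox_iff] at h
      obtain ⟨⟨i, hi⟩, hs'⟩ := h
      obtain ⟨⟨μ', hμ, hμs⟩, -⟩ := exists_add_remove_of_strip (i := i) hs (by
        have h1 := hs' i
        have h2 := hi.1
        omega)
      exact ⟨μ', by simp [hμ.addBox, hμs], i, hi, hμ⟩
    · intro μ' h
      simp only [Finset.mem_filter, mem_up, addBox_iff] at h
      obtain ⟨⟨i, hi⟩, hs'⟩ := h
      obtain ⟨-, ν', hν, hνs⟩ := exists_add_remove_of_strip (i := i) hs (by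
        have h1 := hs' i
        have h2 := hi.1
        omega)
      exact ⟨ν', by simp [hν.addBox, hνs], i, hν, hi⟩
    · rintro a a' b ⟨j, h1, h2⟩ ⟨j', h1', h2'⟩
      obtain rfl := h2.index_unique h2'
      exact h1.left_unique h1'
    · rintro a b b' ⟨j, h1, h2⟩ ⟨j', h1', h2'⟩
      obtain rfl := h1.index_unique h1'
      exact h2.right_unique h2'
  · refine card_eq_of_relation (fun ν' μ' => ∃ j, AddRow ν' (j + 1) ν ∧ AddRow μ j μ')
      ?_ ?_ ?_ ?_
    · intro ν' h
      simp only [Finset.mem_filter, mem_down, addBox_iff] at h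
      obtain ⟨⟨i, hi⟩, hs'⟩ := h
      obtain ⟨j, rfl, -⟩ := exists_eq_succ_of_removeRow hs hi hs'
      obtain ⟨μ', hμ, hμs⟩ := exists_addRow_left_of_not_strip hs hi hs'
      exact ⟨μ', by simp [hμ.addBox, hμs], j, hi, hμ⟩
    · intro μ' h
      simp only [Finset.mem_filter, mem_up, addBox_iff] at h
      obtain ⟨⟨i, hi⟩, hs'⟩ := h
      obtain ⟨ν', hν, hνs⟩ := exists_removeRow_right_of_not_strip hs hi hs'
      exact ⟨ν', by simp [hν.addBox, hνs], i, hν, hi⟩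
    · rintro a a' b ⟨j, h1, h2⟩ ⟨j', h1', h2'⟩
      obtain rfl := h2.index_unique h2'
      exact h1.left_unique h1'
    · rintro a b b' ⟨j, h1, h2⟩ ⟨j', h1', h2'⟩
      obtain rfl : j = j' := by have := h1.index_unique h1'; omega
      exact h2.right_unique h2'

open scoped Classical in
-- Rewrites a double sum through the multiplicity of each `g y`, so that operator identities can be
-- compared coefficient by coefficient.
theorem sum_sum_eq_sum_card_mul {α β : Type*} {s : Finset α} {t : α → Finset β} {B : Finset β}
    (hB : ∀ x ∈ s, t x ⊆ B) (g : β → ℕ) :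
    ∑ x ∈ s, ∑ y ∈ t x, g y = ∑ y ∈ B, {x ∈ s | y ∈ t x}.card * g y := by
  rw [Finset.sum_comm' (t' := B) (s' := fun y => {x ∈ s | y ∈ t x})]
  · simp
  · intro x y
    simp only [Finset.mem_filter]
    exact ⟨fun h => ⟨h, hB x h.1 h.2⟩, fun h => h.1⟩

open scoped Classical in
theorem sum_up_strips (ν : YoungDiagram) (g : YoungDiagram → ℕ) :
    ∑ ν' ∈ up ν, ∑ μ ∈ strips ν', g μ =
      ∑ κ ∈ strips ν, ∑ μ ∈ up κ, g μ + ∑ μ ∈ strips ν, g μ := by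
  set B := (up ν).biUnion strips ∪ (strips ν).biUnion up ∪ strips ν with hB
  have h1 : ∀ x ∈ up ν, strips x ⊆ B := fun x hx y hy => by
    simp only [hB, Finset.mem_union, Finset.mem_biUnion]
    exact Or.inl (Or.inl ⟨x, hx, hy⟩)
  have h2 : ∀ x ∈ strips ν, up x ⊆ B := fun x hx y hy => by
    simp only [hB, Finset.mem_union, Finset.mem_biUnion]
    exact Or.inl (Or.inr ⟨x, hx, hy⟩)
  have h3 : ∑ μ ∈ strips ν, g μ = ∑ μ ∈ B, (if Strip μ ν then 1 else 0) * g μ := by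
    simp only [ite_mul, one_mul, zero_mul]
    rw [← Finset.sum_filter]
    congr 1
    ext x
    simp only [Finset.mem_filter, mem_strips, hB, Finset.mem_union]
    exact ⟨fun h => ⟨Or.inr h, h⟩, And.right⟩
  rw [sum_sum_eq_sum_card_mul h1, sum_sum_eq_sum_card_mul h2, h3, ← Finset.sum_add_distrib]
  refine Finset.sum_congr rfl fun μ _ => ?_
  rw [← add_mul]
  congr 1
  simp only [mem_strips, mem_up]
  rw [card_up_strip]
  congr 2
  ext x
  simp [and_comm]

open scoped Classical in
theorem sum_down_strips (ν : YoungDiagram) (g : YoungDiagram → ℕ) :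
    ∑ ν' ∈ down ν, ∑ μ ∈ strips ν', g μ = ∑ κ ∈ strips ν, ∑ μ ∈ down κ, g μ := by
  set B := (down ν).biUnion strips ∪ (strips ν).biUnion down with hB
  have h1 : ∀ x ∈ down ν, strips x ⊆ B := fun x hx y hy => by
    simp only [hB, Finset.mem_union, Finset.mem_biUnion]
    exact Or.inl ⟨x, hx, hy⟩
  have h2 : ∀ x ∈ strips ν, down x ⊆ B := fun x hx y hy => by
    simp only [hB, Finset.mem_union, Finset.mem_biUnion]
    exact Or.inr ⟨x, hx, hy⟩
  rw [sum_sum_eq_sum_card_mul h1, sum_sum_eq_sum_card_mul h2]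
  refine Finset.sum_congr rfl fun μ _ => ?_
  congr 1
  simp only [mem_strips, mem_down]
  rw [card_down_strip]
  congr 1
  ext x
  simp [and_comm]

/-- Delete a box and add a box, in all possible ways. -/
noncomputable def vac (g : YoungDiagram → ℕ) (ν : YoungDiagram) : ℕ :=
  ∑ ρ ∈ down ν, ∑ μ ∈ up ρ, g μ

/-- Strip deletion commutes with deleting a box, and with adding one up to a correction; the
correction survives as the second sum. -/
theorem vac_sum_strips (ν : YoungDiagram) (g : YoungDiagram → ℕ) :
    vac (fun μ => ∑ κ ∈ strips μ, g κ) ν =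
      ∑ μ ∈ strips ν, vac g μ + ∑ μ ∈ strips ν, ∑ κ ∈ down μ, g κ := by
  simp only [vac, sum_up_strips, Finset.sum_add_distrib, sum_down_strips]

/-! ### Counting chains of horizontal strips -/

/-- The largest element of `S` below `n`, or `0` if there is none. -/
def below (S : Finset ℕ) (n : ℕ) : ℕ := {i ∈ S | i < n}.sup id

theorem below_lt (S : Finset ℕ) {n : ℕ} (hn : 0 < n) : below S n < n := by
  rw [below, Finset.sup_lt_iff (by simpa using hn)]
  intro i hi
  exact (Finset.mem_filter.1 hi).2

theorem le_below {S : Finset ℕ} {n i : ℕ} (hi : i ∈ S) (hin : i < n) : i ≤ below S n :=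
  Finset.le_sup (f := id) (Finset.mem_filter.2 ⟨hi, hin⟩)

theorem below_mem {S : Finset ℕ} {n : ℕ} (h : 0 < below S n) : below S n ∈ S := by
  have hne : {i ∈ S | i < n}.Nonempty := by
    rw [Finset.nonempty_iff_ne_empty]
    intro he
    rw [below, he] at h
    simp at h
  obtain ⟨i, hi, he⟩ := Finset.exists_mem_eq_sup _ hne id
  rw [below, he]
  exact (Finset.mem_filter.1 hi).1

theorem below_eq_of_forall {S : Finset ℕ} {n p : ℕ} (hp : p = 0 ∨ p ∈ S ∧ p < n)
    (h : ∀ i ∈ S, i < n → i ≤ p) : below S n = p := by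
  refine le_antisymm (Finset.sup_le fun i hi => ?_) ?_
  · exact h i (Finset.mem_filter.1 hi).1 (Finset.mem_filter.1 hi).2
  · rcases hp with rfl | hp
    · exact Nat.zero_le _
    · exact le_below hp.1 hp.2

theorem below_insert_of_le {S : Finset ℕ} {n v : ℕ} (hv : v ≤ below S n) :
    below (insert v S) n = below S n := by
  rw [below, Finset.filter_insert]
  split_ifs
  · rw [Finset.sup_insert]
    exact sup_eq_right.2 hv
  · rfl

theorem below_insert_pred {S : Finset ℕ} (n : ℕ) : below (insert n S) (n + 1) = n :=
  below_eq_of_forall (Or.inr ⟨Finset.mem_insert_self _ _, Nat.lt_succ_self _⟩) fun i _ h => by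
    omega

/-- The number of chains of partitions from the empty one to `ν` in which each skew diagram is a
horizontal strip, and the sizes in the chain are `0`, the elements of `S` below `n`, and `n`. -/
noncomputable def chains (S : Finset ℕ) (n : ℕ) (ν : YoungDiagram) : ℕ :=
  if ν.card = n then
    if 0 < n then ∑ μ ∈ strips ν, chains S (below S n) μ else 1
  else 0
termination_by n
decreasing_by exact below_lt S ‹_›

theorem chains_of_card_ne {S : Finset ℕ} {n : ℕ} {ν : YoungDiagram} (h : ν.card ≠ n) :
    chains S n ν = 0 := by
  rw [chains, if_neg h]

theorem chains_zero {S : Finset ℕ} {ν : YoungDiagram} (h : ν.card = 0) :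
    chains S 0 ν = 1 := by
  rw [chains, if_pos h, if_neg (lt_irrefl 0)]

theorem chains_of_pos {S : Finset ℕ} {n : ℕ} (hn : 0 < n) {ν : YoungDiagram}
    (h : ν.card = n) : chains S n ν = ∑ μ ∈ strips ν, chains S (below S n) μ := by
  rw [chains, if_pos h, if_pos hn]

theorem chains_congr {S S' : Finset ℕ} {n : ℕ} (h : ∀ i < n, i ∈ S ↔ i ∈ S')
    (ν : YoungDiagram) : chains S n ν = chains S' n ν := by
  induction n using Nat.strong_induction_on generalizing ν with
  | _ n ih =>
    by_cases hc : ν.card = n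
    · rcases Nat.eq_zero_or_pos n with rfl | hn
      · rw [chains_zero hc, chains_zero hc]
      · have hb : below S n = below S' n := by
          rw [below, below]
          congr 1
          ext i
          simp only [Finset.mem_filter]
          exact ⟨fun hi => ⟨(h i hi.2).1 hi.1, hi.2⟩, fun hi => ⟨(h i hi.2).2 hi.1, hi.2⟩⟩
        rw [chains_of_pos hn hc, chains_of_pos hn hc, ← hb]
        exact Finset.sum_congr rfl fun μ _ =>
          ih _ (below_lt S hn) (fun i hi => h i (hi.trans (below_lt S hn))) μ
    · rw [chains_of_card_ne hc, chains_of_card_ne hc]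

/-! ### Deleting and adding a box, applied to chain counts -/

theorem vac_of_card_ne {g : YoungDiagram → ℕ} {n : ℕ} (hg : ∀ μ, μ.card ≠ n → g μ = 0)
    {ν : YoungDiagram} (hν : ν.card ≠ n) : vac g ν = 0 := by
  refine Finset.sum_eq_zero fun ρ hρ => Finset.sum_eq_zero fun μ hμ => hg μ ?_
  have h1 := (mem_down.1 hρ).card_eq
  have h2 := (mem_up.1 hμ).card_eq
  omega

theorem sum_strips_chains_of_card {S : Finset ℕ} {n : ℕ} {ν : YoungDiagram}
    (hν : ν.card = n) : ∑ μ ∈ strips ν, chains S n μ = chains S n ν := by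
  refine Finset.sum_eq_single_of_mem ν (mem_strips.2 (Strip.refl ν)) fun μ hμ hne => ?_
  refine chains_of_card_ne fun hc => hne ?_
  exact eq_of_le_of_card_le (mem_strips.1 hμ).le (by omega)

theorem sum_strips_chains_of_card_succ {S : Finset ℕ} {n : ℕ} {ν : YoungDiagram}
    (hν : ν.card = n + 1) : ∑ μ ∈ strips ν, chains S n μ = ∑ μ ∈ down ν, chains S n μ := by
  symm
  refine Finset.sum_subset (fun μ hμ => ?_) fun μ hμ hμ' => ?_
  · exact mem_strips.2 (strip_and_card_iff_addBox.2 (mem_down.1 hμ)).1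
  · refine chains_of_card_ne fun hc => hμ' ?_
    exact mem_down.2 (strip_and_card_iff_addBox.1 ⟨mem_strips.1 hμ, by omega⟩)

/-- Deleting one box and then a horizontal strip splits the last block into its initial part and a
final block of size one. -/
theorem sum_down_strips_chains_below {S : Finset ℕ} {n : ℕ} {ν : YoungDiagram}
    (hν : ν.card = n + 1) :
    ∑ ρ ∈ down ν, ∑ μ ∈ strips ρ, chains S (below S (n + 1)) μ =
      chains (insert n S) (n + 1) ν := by
  rw [chains_of_pos (Nat.add_one_pos n) hν, below_insert_pred, sum_strips_chains_of_card_succ hν]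
  refine Finset.sum_congr rfl fun ρ hρ => ?_
  have hρ' : ρ.card = n := by
    have := (mem_down.1 hρ).card_eq
    omega
  rw [chains_congr (S := insert n S) (S' := S) (fun i hi => by
    rw [Finset.mem_insert]
    exact ⟨fun h => h.resolve_left (by omega), Or.inr⟩)]
  have hlt : below S (n + 1) < n + 1 := below_lt S (Nat.add_one_pos n)
  rcases Nat.lt_or_ge (below S (n + 1)) n with h | h
  · have he : below S n = below S (n + 1) := by
      refine below_eq_of_forall ?_ fun i hi hin => le_below hi (by omega)
      rcases Nat.eq_zero_or_pos (below S (n + 1)) with h0 | h0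
      · exact Or.inl h0
      · exact Or.inr ⟨below_mem h0, h⟩
    rw [chains_of_pos (by omega) hρ', he]
  -- The last block already has size one, so the remaining strip is empty.
  · have he : below S (n + 1) = n := by omega
    rw [he, sum_strips_chains_of_card hρ']

/-- The numbers in `{1, …, n}` that lie in `S` or equal `n`. -/
def blockEnds (S : Finset ℕ) (n : ℕ) : Finset ℕ := {v ∈ Finset.Icc 1 n | v ∈ S ∨ v = n}

theorem blockEnds_eq_insert {S : Finset ℕ} {n : ℕ} :
    blockEnds S (n + 1) = insert (n + 1) (blockEnds S (below S (n + 1))) := by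
  ext v
  have hlt : below S (n + 1) < n + 1 := below_lt S (Nat.add_one_pos n)
  simp only [blockEnds, Finset.mem_insert, Finset.mem_filter, Finset.mem_Icc]
  constructor
  · rintro ⟨⟨h1, h2⟩, h3⟩
    by_cases hv : v = n + 1
    · exact Or.inl hv
    · have hS := h3.resolve_right hv
      exact Or.inr ⟨⟨h1, le_below hS (by omega)⟩, Or.inl hS⟩
  · rintro (rfl | ⟨⟨h1, h2⟩, h3⟩)
    · exact ⟨⟨by omega, le_rfl⟩, Or.inr rfl⟩
    · refine ⟨⟨h1, by omega⟩, Or.inl ?_⟩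
      rcases h3 with h | rfl
      · exact h
      · exact below_mem h1

/-- Induction along the blocks: `vac` is commuted past the last strip. The commuted term acts on the
shorter chain and gives all earlier block ends; the correction term splits the last block and gives
the end `n` itself. -/
theorem vac_chains (S : Finset ℕ) (n : ℕ) (ν : YoungDiagram) :
    vac (chains S n) ν = ∑ v ∈ blockEnds S n, chains (insert (v - 1) S) n ν := by
  induction n using Nat.strong_induction_on generalizing ν with
  | _ n ih =>
    by_cases hc : ν.card = n
    swap
    · rw [vac_of_card_ne (fun μ => chains_of_card_ne) hc]
      exact (Finset.sum_eq_zero fun v _ => chains_of_card_ne hc).symm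
    cases n with
    | zero =>
      simp only [blockEnds, vac]
      rw [Finset.sum_eq_zero, Finset.sum_eq_zero]
      · simp
      · intro ρ hρ
        have := (mem_down.1 hρ).card_eq
        omega
    | succ n =>
      have hlt : below S (n + 1) < n + 1 := below_lt S (Nat.add_one_pos n)
      have h1 : vac (chains S (n + 1)) ν =
          vac (fun μ => ∑ κ ∈ strips μ, chains S (below S (n + 1)) κ) ν := by
        refine Finset.sum_congr rfl fun ρ hρ => Finset.sum_congr rfl fun μ hμ => ?_
        have h1 := (mem_down.1 hρ).card_eq
        have h2 := (mem_up.1 hμ).card_eq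
        exact chains_of_pos (Nat.add_one_pos n) (by omega)
      rw [h1, vac_sum_strips, ← sum_down_strips, sum_down_strips_chains_below hc, blockEnds_eq_insert,
        Finset.sum_insert, add_comm, Nat.add_sub_cancel]
      · congr 1
        rw [Finset.sum_congr rfl fun μ _ => ih _ hlt μ, Finset.sum_comm]
        refine Finset.sum_congr rfl fun v hv => ?_
        simp only [blockEnds, Finset.mem_filter, Finset.mem_Icc] at hv
        rw [chains_of_pos (Nat.add_one_pos n) hc, below_insert_of_le (by omega)]
      · simp only [blockEnds, Finset.mem_filter, Finset.mem_Icc]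
        omega

/-! ### Words -/

theorem dedup_append_singleton {α : Type*} [DecidableEq α] (l : List α) (k : α) :
    (l ++ [k]).dedup = l.dedup.filter (· ≠ k) ++ [k] := by
  induction l with
  | nil => simp
  | cons a l ih =>
    rw [List.cons_append, List.dedup_cons, List.dedup_cons, ih]
    by_cases hk : a = k
    · subst hk
      by_cases ha : a ∈ l <;> simp [ha]
    · by_cases ha : a ∈ l <;> simp [ha, hk]

theorem idxOf_filter_lt_iff {α : Type*} [DecidableEq α] (p : α → Bool) {x y : α} (hx : p x)
    (hy : p y) (l : List α) :
    (l.filter p).idxOf x < (l.filter p).idxOf y ↔ l.idxOf x < l.idxOf y := by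
  induction l with
  | nil => simp
  | cons a l ih =>
    by_cases ha : p a
    · rw [List.filter_cons_of_pos ha]
      by_cases h1 : a = x
      · subst h1
        by_cases h2 : a = y
        · subst h2
          simp
        · simp [List.idxOf_cons_ne _ h2]
      · by_cases h2 : a = y
        · subst h2
          simp
        · simp [List.idxOf_cons_ne _ h1, List.idxOf_cons_ne _ h2, ih]
    · have h1 : a ≠ x := by rintro rfl; exact ha hx
      have h2 : a ≠ y := by rintro rfl; exact ha hy
      rw [List.filter_cons_of_neg ha, List.idxOf_cons_ne l h1, List.idxOf_cons_ne l h2, ih]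
      omega

theorem word_snoc {n r : ℕ} (a : Fin r → Fin n) (k : Fin n) :
    word (Fin.snoc a k : Fin (r + 1) → Fin n) = (word a).filter (· ≠ k) ++ [k] := by
  rw [word, rightmost, List.ofFn_succ_last, ← List.append_assoc, Fin.snoc_last,
    dedup_append_singleton]
  simp [word, rightmost]

/-- The letters `i + 1` and `i` are represented in `Fin n` by `x = i` and `y = i - 1`, and the
inverse permutation reads off positions in `word a`. -/
theorem mem_backsteps_wordPerm {n r : ℕ} (a : Fin r → Fin n) (i : ℕ) :
    i ∈ backsteps (wordPerm a) ↔
      ∃ x y : Fin n, (x : ℕ) = i ∧ (y : ℕ) + 1 = i ∧ (word a).idxOf x < (word a).idxOf y := by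
  have key : ∀ x : Fin n, (((wordPerm a).symm x : Fin n) : ℕ) = (word a).idxOf x := fun x => rfl
  simp only [backsteps, Finset.mem_filter, Finset.mem_Icc]
  constructor
  · rintro ⟨-, j, k, h1, h2, h⟩
    refine ⟨wordPerm a j, wordPerm a k, by omega, h2, ?_⟩
    rw [← key, ← key, Equiv.symm_apply_apply, Equiv.symm_apply_apply]
    exact h
  · rintro ⟨x, y, h1, h2, h⟩
    have := x.isLt
    refine ⟨by omega, (wordPerm a).symm x, (wordPerm a).symm y, ?_, ?_, ?_⟩
    · rw [Equiv.apply_symm_apply, h1]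
    · rw [Equiv.apply_symm_apply, h2]
    · rw [Fin.lt_def, key, key]
      exact h

/-- Moving the letter `k + 1` to the end affects only its comparisons with its two neighbours: `k +
2`, if it is a letter, is now on its left, and so is `k`. -/
theorem mem_backsteps_snoc {n r : ℕ} (a : Fin r → Fin n) (k : Fin n) (i : ℕ) :
    i ∈ backsteps (wordPerm (Fin.snoc a k : Fin (r + 1) → Fin n)) ↔
      (i = k + 1 ∧ (k : ℕ) + 1 < n) ∨
        (i ∈ backsteps (wordPerm a) ∧ i ≠ k + 1 ∧ i ≠ k) := by
  rw [mem_backsteps_wordPerm, mem_backsteps_wordPerm, word_snoc]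
  have hlen : ((word a).filter (· ≠ k) ++ [k]).idxOf k = ((word a).filter (· ≠ k)).length := by
    rw [List.idxOf_append_of_notMem (by simp)]
    simp
  have hne : ∀ x, x ≠ k → ((word a).filter (· ≠ k) ++ [k]).idxOf x =
      ((word a).filter (· ≠ k)).idxOf x ∧
      ((word a).filter (· ≠ k)).idxOf x < ((word a).filter (· ≠ k)).length := by
    intro x hx
    have hmem : x ∈ (word a).filter (· ≠ k) := by simp [hx, mem_word]
    exact ⟨List.idxOf_append_of_mem hmem, List.idxOf_lt_length_iff.2 hmem⟩
  constructor
  · rintro ⟨x, y, h1, h2, h⟩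
    have hxk : x ≠ k := by
      rintro rfl
      have hy := (hne y (by rintro rfl; omega))
      rw [hlen, hy.1] at h
      omega
    by_cases hyk : y = k
    · subst hyk
      exact Or.inl ⟨h2.symm, by have := x.isLt; omega⟩
    · rw [(hne x hxk).1, (hne y hyk).1, idxOf_filter_lt_iff _ (by simpa using hxk)
        (by simpa using hyk)] at h
      refine Or.inr ⟨⟨x, y, h1, h2, h⟩, fun hi => hyk (Fin.ext ?_), fun hi => hxk (Fin.ext ?_)⟩
        <;> omega
  · rintro (⟨rfl, h⟩ | ⟨⟨x, y, h1, h2, h⟩, h3, h4⟩)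
    · refine ⟨⟨k + 1, h⟩, k, rfl, rfl, ?_⟩
      have hx := hne ⟨k + 1, h⟩ (by simp [Fin.ext_iff])
      rw [hlen, hx.1]
      exact hx.2
    · have hxk : x ≠ k := by rintro rfl; omega
      have hyk : y ≠ k := by rintro rfl; omega
      refine ⟨x, y, h1, h2, ?_⟩
      rwa [(hne x hxk).1, (hne y hyk).1, idxOf_filter_lt_iff _ (by simpa using hxk)
        (by simpa using hyk)]

theorem lt_of_mem_backsteps_wordPerm {n r : ℕ} {a : Fin r → Fin n} {i : ℕ}
    (h : i ∈ backsteps (wordPerm a)) : i < n := by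
  obtain ⟨x, -, rfl, -⟩ := (mem_backsteps_wordPerm a i).1 h
  exact x.isLt

theorem backsteps_snoc_subset_iff {n r : ℕ} (a : Fin r → Fin n) (k : Fin n) (S : Finset ℕ) :
    backsteps (wordPerm (Fin.snoc a k : Fin (r + 1) → Fin n)) ⊆ S ↔
      ((k : ℕ) + 1 ∈ S ∨ (k : ℕ) + 1 = n) ∧ backsteps (wordPerm a) ⊆ insert (k : ℕ) S := by
  have hk := k.isLt
  constructor
  · intro h
    have h1 : (k : ℕ) + 1 ∈ S ∨ (k : ℕ) + 1 = n := by
      by_cases hn : (k : ℕ) + 1 = n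
      · exact Or.inr hn
      · exact Or.inl (h ((mem_backsteps_snoc a k _).2 (Or.inl ⟨rfl, by omega⟩)))
    refine ⟨h1, fun i hi => Finset.mem_insert.2 ?_⟩
    have := lt_of_mem_backsteps_wordPerm hi
    by_cases hik : i = k
    · exact Or.inl hik
    · by_cases hik' : i = k + 1
      · subst hik'
        exact Or.inr (h1.resolve_right (by omega))
      · exact Or.inr (h ((mem_backsteps_snoc a k i).2 (Or.inr ⟨hi, hik', hik⟩)))
  · rintro ⟨h1, h2⟩ i hi
    rcases (mem_backsteps_snoc a k i).1 hi with ⟨rfl, h⟩ | ⟨h, -, h'⟩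
    · exact h1.resolve_right (by omega)
    · exact (Finset.mem_insert.1 (h2 h)).resolve_left h'

theorem backsteps_wordPerm_zero {n : ℕ} (a : Fin 0 → Fin n) : backsteps (wordPerm a) = ∅ := by
  refine Finset.eq_empty_of_forall_notMem fun i hi => ?_
  obtain ⟨x, y, h1, h2, h⟩ := (mem_backsteps_wordPerm a i).1 hi
  have hw : word a = List.finRange n := by
    simp [word, rightmost, (List.nodup_finRange n).dedup]
  rw [hw, List.idxOf_finRange, List.idxOf_finRange] at h
  omega

theorem sum_blockEnds (S : Finset ℕ) (n : ℕ) (f : ℕ → ℕ) :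
    ∑ v ∈ blockEnds S n, f (v - 1) =
      ∑ k : Fin n, if (k : ℕ) + 1 ∈ S ∨ (k : ℕ) + 1 = n then f k else 0 := by
  rw [Fin.sum_univ_eq_sum_range (fun k => if k + 1 ∈ S ∨ k + 1 = n then f k else 0) n, blockEnds,
    Finset.sum_filter]
  refine Finset.sum_nbij' (· - 1) (· + 1) ?_ ?_ ?_ ?_ ?_
  · intro v hv; simp at hv ⊢; omega
  · intro v hv; simp at hv ⊢; omega
  · intro v hv; simp at hv ⊢; omega
  · intro v hv; simp
  · intro v hv
    rw [Finset.mem_Icc] at hv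
    rw [Nat.sub_add_cancel hv.1]

/-- The number of words whose permutation has all its backsteps in `S`. -/
def wordCount (n r : ℕ) (S : Finset ℕ) : ℕ :=
  Finset.card {a : Fin r → Fin n | backsteps (wordPerm a) ⊆ S}

theorem wordCount_zero (n : ℕ) (S : Finset ℕ) : wordCount n 0 S = 1 := by
  simp [wordCount, backsteps_wordPerm_zero]

/-- Sorts the words by their last letter `v = k + 1`. -/
theorem wordCount_succ (n r : ℕ) (S : Finset ℕ) :
    wordCount n (r + 1) S = ∑ v ∈ blockEnds S n, wordCount n r (insert (v - 1) S) := by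
  rw [sum_blockEnds S n fun k => wordCount n r (insert k S)]
  simp only [wordCount, Finset.card_filter]
  rw [← (Fin.snocEquiv fun _ : Fin (r + 1) => Fin n).sum_comp, Fintype.sum_prod_type]
  refine Finset.sum_congr rfl fun k _ => ?_
  have h : ∀ a : Fin r → Fin n, (Fin.snocEquiv fun _ : Fin (r + 1) => Fin n) (k, a) =
      (Fin.snoc a k : Fin (r + 1) → Fin n) := fun _ => rfl
  simp only [h, backsteps_snoc_subset_iff]
  split_ifs with h <;> simp [h]

/-! ### Standard tableaux as functions on cells -/

namespace StandardTableau

variable {μ : YoungDiagram}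

/-- The entry of a cell, and `0` outside the diagram. -/
def fill (T : StandardTableau μ) (c : ℕ × ℕ) : ℕ :=
  if h : c ∈ μ.cells then (T.entry ⟨c, h⟩).1 else 0

theorem fill_eq (T : StandardTableau μ) (c : {c : ℕ × ℕ // c ∈ μ.cells}) :
    T.fill c.1 = (T.entry c).1 := dif_pos c.2

theorem fill_mem (T : StandardTableau μ) {c : ℕ × ℕ} (hc : c ∈ μ.cells) :
    T.fill c ∈ Finset.Icc 1 μ.card := by
  rw [T.fill_eq ⟨c, hc⟩]
  exact (T.entry _).2

theorem fill_injOn (T : StandardTableau μ) {c d : ℕ × ℕ} (hc : c ∈ μ.cells) (hd : d ∈ μ.cells)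
    (h : T.fill c = T.fill d) : c = d := by
  rw [T.fill_eq ⟨c, hc⟩, T.fill_eq ⟨d, hd⟩] at h
  exact congrArg Subtype.val (T.entry.injective (Subtype.ext h))

theorem exists_fill_eq (T : StandardTableau μ) {k : ℕ} (hk : k ∈ Finset.Icc 1 μ.card) :
    ∃ c ∈ μ.cells, T.fill c = k := by
  refine ⟨(T.entry.symm ⟨k, hk⟩).1, (T.entry.symm ⟨k, hk⟩).2, ?_⟩
  rw [fill_eq, Equiv.apply_symm_apply]

theorem fill_row_lt (T : StandardTableau μ) {i j k : ℕ} (hjk : j < k) (hk : (i, k) ∈ μ.cells) :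
    T.fill (i, j) < T.fill (i, k) := by
  have hj : (i, j) ∈ μ.cells := μ.isLowerSet (Prod.mk_le_mk.2 ⟨le_rfl, hjk.le⟩) hk
  rw [T.fill_eq ⟨_, hj⟩, T.fill_eq ⟨_, hk⟩]
  exact T.row_lt _ _ rfl hjk

theorem fill_col_lt (T : StandardTableau μ) {i j k : ℕ} (hik : i < k) (hk : (k, j) ∈ μ.cells) :
    T.fill (i, j) < T.fill (k, j) := by
  have hi : (i, j) ∈ μ.cells := μ.isLowerSet (Prod.mk_le_mk.2 ⟨hik.le, le_rfl⟩) hk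
  rw [T.fill_eq ⟨_, hi⟩, T.fill_eq ⟨_, hk⟩]
  exact T.col_lt _ _ rfl hik

theorem ext_fill {T T' : StandardTableau μ} (h : ∀ c ∈ μ.cells, T.fill c = T'.fill c) :
    T = T' := by
  have he : T.entry = T'.entry := by
    ext c
    rw [← fill_eq, ← fill_eq, h c.1 c.2]
  cases T
  cases T'
  simpa using he

theorem exists_of_fill (f : ℕ × ℕ → ℕ) (hf : ∀ c ∈ μ.cells, f c ∈ Finset.Icc 1 μ.card)
    (hinj : Set.InjOn f μ.cells)
    (hrow : ∀ i j k, j < k → (i, k) ∈ μ.cells → f (i, j) < f (i, k))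
    (hcol : ∀ i j k, i < k → (k, j) ∈ μ.cells → f (i, j) < f (k, j)) :
    ∃ T : StandardTableau μ, ∀ c ∈ μ.cells, T.fill c = f c := by
  let g : {c : ℕ × ℕ // c ∈ μ.cells} → {k : ℕ // k ∈ Finset.Icc 1 μ.card} :=
    fun c => ⟨f c.1, hf c.1 c.2⟩
  have hg : Function.Bijective g := by
    refine (Fintype.bijective_iff_injective_and_card g).2 ⟨fun c d h => ?_, ?_⟩
    · exact Subtype.ext (hinj c.2 d.2 (congrArg Subtype.val h))
    · simp
  refine ⟨⟨Equiv.ofBijective g hg, ?_, ?_⟩, fun c hc => dif_pos hc⟩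
  · rintro ⟨⟨i, j⟩, hc⟩ ⟨⟨i', k⟩, hd⟩ h1 h2
    simp only at h1 h2
    subst h1
    exact hrow i j k h2 hd
  · rintro ⟨⟨i, j⟩, hc⟩ ⟨⟨k, j'⟩, hd⟩ h1 h2
    simp only at h1 h2
    subst h1
    exact hcol i j k h2 hd

theorem mem_descents_iff (T : StandardTableau μ) {i : ℕ} :
    i ∈ T.descents ↔
      ∃ c ∈ μ.cells, ∃ d ∈ μ.cells, T.fill c = i ∧ T.fill d = i + 1 ∧ c.1 < d.1 := by
  simp only [descents, Finset.mem_filter]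
  constructor
  · rintro ⟨-, c, d, h1, h2, h3⟩
    exact ⟨c.1, c.2, d.1, d.2, by rw [fill_eq, h1], by rw [fill_eq, h2], h3⟩
  · rintro ⟨c, hc, d, hd, h1, h2, h3⟩
    refine ⟨h1 ▸ T.fill_mem hc, ⟨c, hc⟩, ⟨d, hd⟩, ?_, ?_, h3⟩
    · rw [← fill_eq, h1]
    · rw [← fill_eq, h2]

end StandardTableau

/-! ### Removing the largest entry of a standard tableau -/

/-- `T` restricts to `T'`. -/
def Restricts {μ ν : YoungDiagram} (T : StandardTableau ν) (T' : StandardTableau μ) : Prop :=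
  ∀ c ∈ μ.cells, T.fill c = T'.fill c

section peel

variable {μ ν : YoungDiagram} {c : ℕ × ℕ}

/-- The smaller values are all taken by `T'`. -/
theorem Restricts.fill_corner {T : StandardTableau ν} {T' : StandardTableau μ}
    (h : Restricts T T') (hc : c ∉ μ.cells) (hν : ν.cells = insert c μ.cells) :
    T.fill c = ν.card := by
  have hcν : c ∈ ν.cells := hν ▸ Finset.mem_insert_self _ _
  have h1 := Finset.mem_Icc.1 (T.fill_mem hcν)
  have hcard : ν.card = μ.card + 1 := AddBox.card_eq ⟨c, hc, hν⟩
  by_contra hne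
  obtain ⟨d, hd, he⟩ := T'.exists_fill_eq (k := T.fill c) (Finset.mem_Icc.2 ⟨h1.1, by omega⟩)
  rw [← h d hd] at he
  have := T.fill_injOn (hν ▸ Finset.mem_insert_of_mem hd) hcν he
  exact hc (this ▸ hd)

theorem exists_extension (T' : StandardTableau μ) (h : AddBox μ ν) :
    ∃ T : StandardTableau ν, Restricts T T' := by
  have hcard := h.card_eq
  obtain ⟨c, hc, hν⟩ := h
  have hne : ∀ d ∈ μ.cells, d ≠ c := fun d hd he => hc (he ▸ hd)
  have hlow : ∀ d e, d ≤ e → d ≠ c → e ∈ ν.cells → d ∈ μ.cells := fun d e hde hd he =>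
    (Finset.mem_insert.1 (hν ▸ ν.isLowerSet hde he)).resolve_left hd
  have hmax : ∀ e ∈ μ.cells, ¬ c ≤ e := fun e he hce => hc (μ.isLowerSet hce he)
  have hle : ∀ d ∈ μ.cells, T'.fill d ≤ μ.card := fun d hd =>
    (Finset.mem_Icc.1 (T'.fill_mem hd)).2
  have hlt : ∀ d e, d ≤ e → d ≠ e → e ∈ ν.cells → (e ∈ μ.cells → T'.fill d < T'.fill e) →
      (if d = c then ν.card else T'.fill d) < if e = c then ν.card else T'.fill e := by
    intro d e hde hdne he hT
    by_cases hec : e = c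
    · subst hec
      rw [if_neg hdne, if_pos rfl]
      have := hle d (hlow d e hde hdne he)
      omega
    · have heμ := hlow e e le_rfl hec he
      have hdc : d ≠ c := by
        rintro rfl
        exact hmax e heμ hde
      rw [if_neg hec, if_neg hdc]
      exact hT heμ
  obtain ⟨T, hT⟩ := StandardTableau.exists_of_fill (μ := ν)
    (fun d => if d = c then ν.card else T'.fill d) (by
      intro d hd
      rw [Finset.mem_Icc]
      split_ifs with hdc
      · omega
      · have := Finset.mem_Icc.1 (T'.fill_mem (hlow d d le_rfl hdc hd))
        omega) (by
      intro d hd e he hde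
      simp only at hde
      by_cases hdc : d = c <;> by_cases hec : e = c
      · rw [hdc, hec]
      · rw [if_pos hdc, if_neg hec] at hde
        have := hle e (hlow e e le_rfl hec he)
        omega
      · rw [if_neg hdc, if_pos hec] at hde
        have := hle d (hlow d d le_rfl hdc hd)
        omega
      · rw [if_neg hdc, if_neg hec] at hde
        exact T'.fill_injOn (hlow d d le_rfl hdc hd) (hlow e e le_rfl hec he) hde) (by
      intro i j k hjk hk
      refine hlt _ _ (Prod.mk_le_mk.2 ⟨le_rfl, hjk.le⟩) ?_ hk fun h => T'.fill_row_lt hjk h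
      simp
      omega) (by
      intro i j k hik hk
      refine hlt _ _ (Prod.mk_le_mk.2 ⟨hik.le, le_rfl⟩) ?_ hk fun h => T'.fill_col_lt hik h
      simp
      omega)
  refine ⟨T, fun d hd => ?_⟩
  rw [hT d (hν ▸ Finset.mem_insert_of_mem hd), if_neg (hne d hd)]

/-- Entries increase to the right and downwards, so no cell lies beyond the one holding the largest
entry; erasing it leaves a diagram. -/
theorem exists_restriction (T : StandardTableau ν) (hν : 0 < ν.card) :
    ∃ μ, AddBox μ ν ∧ ∃ T' : StandardTableau μ, Restricts T T' := by
  obtain ⟨c, hc, hTc⟩ := T.exists_fill_eq (k := ν.card) (Finset.mem_Icc.2 ⟨hν, le_rfl⟩)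
  let μ : YoungDiagram :=
    { cells := ν.cells.erase c
      isLowerSet := by
        rintro ⟨i, j⟩ ⟨k, l⟩ ⟨h1, h2⟩ h
        simp only at h1 h2
        rw [Finset.mem_coe, Finset.mem_erase] at h ⊢
        have hkl : (k, l) ∈ ν.cells := ν.isLowerSet (Prod.mk_le_mk.2 ⟨h1, h2⟩) h.2
        refine ⟨?_, hkl⟩
        rintro rfl
        have hle := (Finset.mem_Icc.1 (T.fill_mem h.2)).2
        have h3 : T.fill (k, l) ≤ T.fill (k, j) := by
          rcases h2.lt_or_eq with h2 | rfl
          · exact (T.fill_row_lt h2 (ν.isLowerSet (Prod.mk_le_mk.2 ⟨h1, le_rfl⟩) h.2)).le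
          · exact le_rfl
        have h4 : T.fill (k, j) ≤ T.fill (i, j) := by
          rcases h1.lt_or_eq with h1 | rfl
          · exact (T.fill_col_lt h1 h.2).le
          · exact le_rfl
        exact h.1 (T.fill_injOn h.2 hc (by omega)) }
  have hcμ : c ∉ μ.cells := Finset.notMem_erase _ _
  have hins : ν.cells = insert c μ.cells := (Finset.insert_erase hc).symm
  have hbox : AddBox μ ν := ⟨c, hcμ, hins⟩
  have hcard := hbox.card_eq
  have hsub : ∀ d ∈ μ.cells, d ∈ ν.cells := fun d hd => Finset.mem_of_mem_erase hd
  obtain ⟨T', hT'⟩ := StandardTableau.exists_of_fill (μ := μ) T.fill (by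
      intro d hd
      have h1 := Finset.mem_Icc.1 (T.fill_mem (hsub d hd))
      have h2 : T.fill d ≠ ν.card := fun he =>
        hcμ (T.fill_injOn (hsub d hd) hc (he.trans hTc.symm) ▸ hd)
      rw [Finset.mem_Icc]
      omega)
    (fun d hd e he h => T.fill_injOn (hsub d hd) (hsub e he) h)
    (fun i j k hjk hk => T.fill_row_lt hjk (hsub _ hk))
    (fun i j k hik hk => T.fill_col_lt hik (hsub _ hk))
  exact ⟨μ, hbox, T', fun d hd => (hT' d hd).symm⟩

theorem Restricts.left_unique {T₁ T₂ : StandardTableau ν} {T' : StandardTableau μ}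
    (hμ : AddBox μ ν) (h₁ : Restricts T₁ T') (h₂ : Restricts T₂ T') : T₁ = T₂ := by
  obtain ⟨c, hc, hν⟩ := hμ
  refine StandardTableau.ext_fill fun d hd => ?_
  rw [hν, Finset.mem_insert] at hd
  rcases hd with rfl | hd
  · rw [h₁.fill_corner hc hν, h₂.fill_corner hc hν]
  · rw [h₁ d hd, h₂ d hd]

theorem Restricts.right_unique {T : StandardTableau ν} {p q : Σ μ, StandardTableau μ}
    (hp : AddBox p.1 ν) (hq : AddBox q.1 ν) (h₁ : Restricts T p.2) (h₂ : Restricts T q.2) :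
    p = q := by
  obtain ⟨μ₁, T₁⟩ := p
  obtain ⟨μ₂, T₂⟩ := q
  obtain ⟨c, hc, hν⟩ := hp
  obtain ⟨d, hd, hν'⟩ := hq
  simp only at hc hν hd hν'
  have hcd : c = d := T.fill_injOn (hν ▸ Finset.mem_insert_self _ _)
    (hν' ▸ Finset.mem_insert_self _ _)
    ((h₁.fill_corner hc hν).trans (h₂.fill_corner hd hν').symm)
  subst hcd
  obtain rfl : μ₁ = μ₂ := by
    apply YoungDiagram.ext
    rw [← Finset.erase_insert hc, ← hν, hν', Finset.erase_insert hd]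
  obtain rfl : T₁ = T₂ :=
    StandardTableau.ext_fill fun e he => (h₁ e he).symm.trans (h₂ e he)
  rfl

/-- The only possible new descent is at `μ.card`. It must be avoided when `μ.card ∉ S`; when `μ.card
∈ S` the bound `0` imposes nothing. -/
theorem Restricts.descents_subset_iff {T : StandardTableau ν} {T' : StandardTableau μ}
    (h : Restricts T T') (hc : c ∉ μ.cells) (hν : ν.cells = insert c μ.cells) (S : Finset ℕ) :
    T.descents ⊆ S ↔ T'.descents ⊆ S ∧
      ∀ d ∈ μ.cells, T'.fill d = μ.card → (if μ.card ∈ S then 0 else c.1) ≤ d.1 := by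
  have hcard : ν.card = μ.card + 1 := AddBox.card_eq ⟨c, hc, hν⟩
  have hTc := h.fill_corner hc hν
  have hcν : c ∈ ν.cells := hν ▸ Finset.mem_insert_self _ _
  have hsub : ∀ d ∈ μ.cells, d ∈ ν.cells := fun d hd => hν ▸ Finset.mem_insert_of_mem hd
  constructor
  · intro hS
    refine ⟨fun i hi => ?_, fun d hd hTd => ?_⟩
    · obtain ⟨a, ha, b, hb, h1, h2, h3⟩ := T'.mem_descents_iff.1 hi
      exact hS (T.mem_descents_iff.2 ⟨a, hsub a ha, b, hsub b hb, by rw [h a ha, h1],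
        by rw [h b hb, h2], h3⟩)
    · split_ifs with hm
      · exact Nat.zero_le _
      · by_contra hlt
        exact hm (hS (T.mem_descents_iff.2 ⟨d, hsub d hd, c, hcν, by rw [h d hd, hTd],
          by rw [hTc, hcard], not_le.1 hlt⟩))
  · rintro ⟨h1, h2⟩ i hi
    obtain ⟨a, ha, b, hb, ha', hb', hab⟩ := T.mem_descents_iff.1 hi
    rw [hν, Finset.mem_insert] at ha hb
    have hac : a ≠ c := by
      rintro rfl
      have hbν : b ∈ ν.cells := hν ▸ Finset.mem_insert.2 hb
      have := (Finset.mem_Icc.1 (T.fill_mem hbν)).2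
      omega
    have haμ := ha.resolve_left hac
    rcases hb with rfl | hb
    · have hi' : i = μ.card := by omega
      have h3 := h2 a haμ (by rw [← h a haμ, ha', hi'])
      split_ifs at h3 with hm
      · rwa [hi']
      · omega
    · exact h1 (T'.mem_descents_iff.2 ⟨a, haμ, b, hb, by rw [← h a haμ, ha'],
        by rw [← h b hb, hb'], hab⟩)

theorem Restricts.row_le_iff {T : StandardTableau ν} {T' : StandardTableau μ}
    (h : Restricts T T') (hc : c ∉ μ.cells) (hν : ν.cells = insert c μ.cells) (i : ℕ) :
    (∀ d ∈ ν.cells, T.fill d = ν.card → i ≤ d.1) ↔ i ≤ c.1 := by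
  have hcν : c ∈ ν.cells := hν ▸ Finset.mem_insert_self _ _
  have hTc := h.fill_corner hc hν
  constructor
  · intro h'
    exact h' c hcν hTc
  · intro hi d hd hTd
    rwa [T.fill_injOn hd hcν (hTd.trans hTc.symm)]

end peel

/-- The first row in which two diagrams differ. -/
noncomputable def diffRow (μ ν : YoungDiagram) : ℕ := sInf {j | μ.rowLen j ≠ ν.rowLen j}

theorem AddRow.diffRow_eq {μ ν : YoungDiagram} {i : ℕ} (h : AddRow μ i ν) :
    diffRow μ ν = i := by
  have h1 := h.1
  have : {j | μ.rowLen j ≠ ν.rowLen j} = {i} := by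
    ext j
    by_cases hj : j = i
    · subst hj
      simp
      omega
    · simp [hj, h.2 j hj]
  rw [diffRow, this, csInf_singleton]

open scoped Classical in
/-- The number of standard tableaux with all descents in `S` and with the largest entry in row `i`
or below. -/
noncomputable def tabCount (S : Finset ℕ) (i : ℕ) (ν : YoungDiagram) : ℕ :=
  Finset.card {T : StandardTableau ν |
    T.descents ⊆ S ∧ ∀ c ∈ ν.cells, T.fill c = ν.card → i ≤ c.1}

open scoped Classical in
-- Removal of the largest entry. The row bound in `tabCount` is what closes the recursion:
-- forbidding a descent at `n` bounds the row of `n` by that of `n + 1`.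
theorem tabCount_succ {S : Finset ℕ} {i n : ℕ} {ν : YoungDiagram} (hν : ν.card = n + 1) :
    tabCount S i ν =
      ∑ μ ∈ down ν with i ≤ diffRow μ ν, tabCount S (if n ∈ S then 0 else diffRow μ ν) μ := by
  simp only [tabCount]
  rw [← Finset.card_sigma]
  have key : ∀ (T : StandardTableau ν) (μ : YoungDiagram) (T' : StandardTableau μ),
      AddBox μ ν → Restricts T T' →
      ((T.descents ⊆ S ∧ ∀ c ∈ ν.cells, T.fill c = ν.card → i ≤ c.1) ↔
      i ≤ diffRow μ ν ∧ T'.descents ⊆ S ∧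
        ∀ c ∈ μ.cells, T'.fill c = μ.card → (if n ∈ S then 0 else diffRow μ ν) ≤ c.1) := by
    intro T μ T' hμ hT
    obtain ⟨c, hc, hins⟩ := hμ
    have hd : diffRow μ ν = c.1 := (addRow_of_cells_eq hc hins).2.diffRow_eq
    have hcard : n = μ.card := by
      have : ν.card = μ.card + 1 := AddBox.card_eq ⟨c, hc, hins⟩
      omega
    rw [hT.descents_subset_iff hc hins, hT.row_le_iff hc hins, hd, hcard]
    tauto
  refine le_antisymm
    (Finset.card_le_card_of_forall_subsingleton
      (fun T p => AddBox p.1 ν ∧ Restricts T p.2) ?_ ?_)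
    (Finset.card_le_card_of_forall_subsingleton'
      (fun T p => AddBox p.1 ν ∧ Restricts T p.2) ?_ ?_)
  · intro T hT
    obtain ⟨μ, hμ, T', hT'⟩ := exists_restriction T (by omega)
    have := (key T μ T' hμ hT').1 (Finset.mem_filter.1 hT).2
    refine ⟨⟨μ, T'⟩, ?_, hμ, hT'⟩
    simp only [Finset.mem_sigma, Finset.mem_filter, Finset.mem_univ, true_and, mem_down]
    exact ⟨⟨hμ, this.1⟩, this.2⟩
  · rintro p - T₁ ⟨-, hp, h₁⟩ T₂ ⟨-, -, h₂⟩
    exact h₁.left_unique hp h₂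
  · rintro ⟨μ, T'⟩ hp
    simp only [Finset.mem_sigma, Finset.mem_filter, Finset.mem_univ, true_and, mem_down] at hp
    obtain ⟨T, hT⟩ := exists_extension T' hp.1.1
    refine ⟨T, ?_, hp.1.1, hT⟩
    simp only [Finset.mem_filter, Finset.mem_univ, true_and]
    exact (key T μ T' hp.1.1 hT).2 ⟨hp.1.2, hp.2⟩
  · rintro T - p ⟨-, hp, h₁⟩ q ⟨-, hq, h₂⟩
    exact h₁.right_unique hp hq h₂

open scoped Classical in
theorem tabCount_of_card_eq_zero {S : Finset ℕ} {i : ℕ} {ν : YoungDiagram} (hν : ν.card = 0) :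
    tabCount S i ν = 1 := by
  have he : ν.cells = ∅ := Finset.card_eq_zero.1 hν
  obtain ⟨T, -⟩ := StandardTableau.exists_of_fill (μ := ν) (fun _ => 0) (by simp [he])
    (by simp [he]) (by simp [he]) (by simp [he])
  rw [tabCount, Finset.card_eq_one]
  refine ⟨T, Finset.eq_singleton_iff_unique_mem.2 ⟨?_, fun T' _ => ?_⟩⟩
  · simp only [Finset.mem_filter, Finset.mem_univ, true_and, he, Finset.notMem_empty, false_imp_iff,
      implies_true, and_true]
    intro i hi
    obtain ⟨c, hc, -⟩ := T.mem_descents_iff.1 hi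
    simp [he] at hc
  · exact StandardTableau.ext_fill (by simp [he])

/-! ### Standard tableaux and chains of horizontal strips -/

theorem diffRow_spec {μ ν : YoungDiagram} (h : μ ≠ ν) :
    μ.rowLen (diffRow μ ν) ≠ ν.rowLen (diffRow μ ν) ∧
      ∀ k < diffRow μ ν, μ.rowLen k = ν.rowLen k := by
  have hne : {j | μ.rowLen j ≠ ν.rowLen j}.Nonempty := by
    by_contra he
    refine h (ext_rowLen fun i => ?_)
    by_contra hi
    exact he ⟨i, hi⟩
  refine ⟨Nat.sInf_mem hne, fun k hk => ?_⟩
  by_contra hk'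
  exact Nat.notMem_of_lt_sInf hk hk'

theorem diffRow_eq_of {μ ν : YoungDiagram} {j : ℕ} (h : μ.rowLen j ≠ ν.rowLen j)
    (h' : ∀ k < j, μ.rowLen k = ν.rowLen k) : diffRow μ ν = j := by
  have hne : μ ≠ ν := by
    rintro rfl
    exact h rfl
  have hs := diffRow_spec hne
  rcases lt_trichotomy (diffRow μ ν) j with hlt | he | hlt
  · exact absurd (h' _ hlt) hs.1
  · exact he
  · exact absurd (hs.2 _ hlt) h

theorem le_diffRow_iff {μ ν : YoungDiagram} (h : μ ≠ ν) {i : ℕ} :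
    i ≤ diffRow μ ν ↔ ∀ k < i, μ.rowLen k = ν.rowLen k := by
  have hs := diffRow_spec h
  constructor
  · intro hi k hk
    exact hs.2 k (by omega)
  · intro hi
    by_contra hlt
    exact hs.1 (hi _ (not_le.1 hlt))

theorem AddRow.ne {μ ν : YoungDiagram} {i : ℕ} (h : AddRow μ i ν) : μ ≠ ν := by
  rintro rfl
  have := h.1
  omega

/-- Since `κ` and `ν` agree above row `j`, the added box lies in the topmost row of `ν / κ`, where
nothing above can spoil the strip. `exists_agree` is the converse: delete the last box of that
topmost row. -/
theorem strip_of_agree {κ μ ν : YoungDiagram} {j : ℕ} (hμ : AddRow μ j ν) (hs : Strip κ μ)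
    (hag : ∀ k < j, κ.rowLen k = μ.rowLen k) :
    Strip κ ν ∧ diffRow κ ν = j ∧ κ ≠ ν := by
  have h1 := hμ.1
  have h2 := hs j
  have hne : κ.rowLen j ≠ ν.rowLen j := by omega
  refine ⟨fun k => ?_, diffRow_eq_of hne fun k hk => ?_, ?_⟩
  · have h3 := hs k
    have h4 := hag k
    have h5 := hμ.2 k
    have h6 := hμ.2 (k + 1)
    have h7 := rowLen_succ_le ν k
    grind
  · rw [hag k hk, hμ.2 k hk.ne]
  · rintro rfl
    exact hne rfl

theorem exists_agree {κ ν : YoungDiagram} (hs : Strip κ ν) (hne : κ ≠ ν) :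
    ∃ μ, AddRow μ (diffRow κ ν) ν ∧ Strip κ μ ∧
      ∀ k < diffRow κ ν, κ.rowLen k = μ.rowLen k := by
  obtain ⟨h1, h2⟩ := diffRow_spec hne
  set j := diffRow κ ν
  have h3 := hs j
  obtain ⟨-, μ, hμ, hκμ⟩ := exists_add_remove_of_strip (i := j) hs (by omega)
  refine ⟨μ, hμ, hκμ, fun k hk => ?_⟩
  rw [h2 k hk, hμ.2 k hk.ne]

open scoped Classical in
-- The last block fills a strip `ν / κ` with its largest entry in the topmost row of the strip, so
-- the row bound `i` says that `κ` and `ν` agree above row `i`. The general `i` is needed for the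
-- induction; `i = 0` gives the chain count.
theorem tabCount_eq (S : Finset ℕ) (n : ℕ) :
    ∀ ν : YoungDiagram, ν.card = n →
      (0 < n → ∀ i, tabCount S i ν =
        ∑ κ ∈ strips ν with ∀ k < i, κ.rowLen k = ν.rowLen k, chains S (below S n) κ) ∧
      tabCount S 0 ν = chains S n ν := by
  induction n with
  | zero =>
    intro ν hν
    exact ⟨fun h => absurd h (lt_irrefl 0), by
      rw [tabCount_of_card_eq_zero hν, chains_zero hν]⟩
  | succ n ih =>
    intro ν hν
    have main : ∀ i, tabCount S i ν =
        ∑ κ ∈ strips ν with ∀ k < i, κ.rowLen k = ν.rowLen k,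
          chains S (below S (n + 1)) κ := by
      intro i
      rw [tabCount_succ hν]
      have hcard : ∀ {μ}, AddBox μ ν → μ.card = n := fun h => by
        have := h.card_eq
        omega
      have hlt : below S (n + 1) < n + 1 := below_lt S (Nat.add_one_pos n)
      by_cases hn : below S (n + 1) = n
      · have h1 : ∀ μ ∈ {μ ∈ down ν | i ≤ diffRow μ ν},
            tabCount S (if n ∈ S then 0 else diffRow μ ν) μ = chains S n μ := by
          intro μ hμ
          have hμ' := hcard (mem_down.1 (Finset.mem_filter.1 hμ).1)
          -- `below S 1 = 0` does not tell whether `0 ∈ S`, so `n = 0` is treated apart.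
          rcases Nat.eq_zero_or_pos n with rfl | hpos
          · rw [tabCount_of_card_eq_zero hμ', chains_zero hμ']
          · rw [if_pos (by
              have := below_mem (S := S) (n := n + 1) (by omega)
              rwa [hn] at this)]
            exact (ih μ hμ').2
        rw [Finset.sum_congr rfl h1, hn]
        refine Finset.sum_subset (fun μ hμ => ?_) fun μ hμ hμ' => ?_
        · rw [Finset.mem_filter, mem_down] at hμ
          rw [Finset.mem_filter, mem_strips]
          obtain ⟨j, hj⟩ := addBox_iff.1 hμ.1
          exact ⟨hj.strip, (le_diffRow_iff hj.ne).1 hμ.2⟩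
        · refine chains_of_card_ne fun hc => hμ' ?_
          rw [Finset.mem_filter, mem_strips] at hμ
          rw [Finset.mem_filter, mem_down]
          have hbox := strip_and_card_iff_addBox.1 ⟨hμ.1, by omega⟩
          obtain ⟨j, hj⟩ := addBox_iff.1 hbox
          exact ⟨hbox, (le_diffRow_iff hj.ne).2 hμ.2⟩
      · have hnS : n ∉ S := fun h => hn (le_antisymm (by omega) (le_below h (Nat.lt_succ_self n)))
        have hb : below S n = below S (n + 1) := by
          refine below_eq_of_forall ?_ fun i hi hin => le_below hi (by omega)
          rcases Nat.eq_zero_or_pos (below S (n + 1)) with h0 | h0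
          · exact Or.inl h0
          · exact Or.inr ⟨below_mem h0, by omega⟩
        have h1 : ∀ μ ∈ {μ ∈ down ν | i ≤ diffRow μ ν},
            tabCount S (if n ∈ S then 0 else diffRow μ ν) μ =
              ∑ κ ∈ strips μ with ∀ k < diffRow μ ν, κ.rowLen k = μ.rowLen k,
                chains S (below S (n + 1)) κ := by
          intro μ hμ
          rw [if_neg hnS, (ih μ (hcard (mem_down.1 (Finset.mem_filter.1 hμ).1))).1 (by omega), hb]
        rw [Finset.sum_congr rfl h1]
        -- The term `κ = ν` vanishes by size, and `diffRow` locates the top of the strip only for `κ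
        -- ≠ ν`.
        have h2 : ∑ κ ∈ strips ν with ∀ k < i, κ.rowLen k = ν.rowLen k,
              chains S (below S (n + 1)) κ =
            ∑ κ ∈ strips ν with (∀ k < i, κ.rowLen k = ν.rowLen k) ∧ κ ≠ ν,
              chains S (below S (n + 1)) κ := by
          symm
          refine Finset.sum_subset (fun κ hκ => ?_) fun κ hκ hκ' => ?_
          · rw [Finset.mem_filter] at hκ ⊢
            exact ⟨hκ.1, hκ.2.1⟩
          · refine chains_of_card_ne ?_
            have : κ = ν := by
              by_contra hne
              rw [Finset.mem_filter] at hκ hκ'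
              exact hκ' ⟨hκ.1, hκ.2, hne⟩
            rw [this]
            omega
        rw [h2, Finset.sum_comm' (t' := {κ ∈ strips ν |
              (∀ k < i, κ.rowLen k = ν.rowLen k) ∧ κ ≠ ν})
            (s' := fun κ => {μ ∈ down ν | Strip κ μ ∧
              ∀ k < diffRow μ ν, κ.rowLen k = μ.rowLen k})]
        · refine Finset.sum_congr rfl fun κ hκ => ?_
          rw [Finset.mem_filter, mem_strips] at hκ
          obtain ⟨μ, hμ, hκμ, hag⟩ := exists_agree hκ.1 hκ.2.2
          -- Given `κ`, the intermediate `μ` is forced: the deleted box ends the topmost row of `ν /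
          -- κ`.
          have hone : {μ ∈ down ν | Strip κ μ ∧
              ∀ k < diffRow μ ν, κ.rowLen k = μ.rowLen k} = {μ} := by
            refine Finset.eq_singleton_iff_unique_mem.2 ⟨?_, fun μ' hμ' => ?_⟩
            · rw [Finset.mem_filter, mem_down, hμ.diffRow_eq]
              exact ⟨hμ.addBox, hκμ, hag⟩
            · rw [Finset.mem_filter, mem_down, addBox_iff] at hμ'
              obtain ⟨⟨j, hj⟩, h3, h4⟩ := hμ'
              rw [hj.diffRow_eq] at h4
              rw [(strip_of_agree hj h3 h4).2.1] at hμ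
              exact hj.left_unique hμ
          rw [hone, Finset.sum_singleton]
        · intro μ κ
          simp only [Finset.mem_filter, mem_down, mem_strips]
          constructor
          · rintro ⟨⟨h3, h4⟩, h5, h6⟩
            obtain ⟨j, hj⟩ := addBox_iff.1 h3
            have h7 := hj.diffRow_eq
            obtain ⟨h8, h9, h10⟩ := strip_of_agree hj h5 (h7 ▸ h6)
            exact ⟨⟨h3, h5, h6⟩, h8, (le_diffRow_iff h10).1 (by omega), h10⟩
          · rintro ⟨⟨h3, h5, h6⟩, h8, h9, h10⟩
            obtain ⟨j, hj⟩ := addBox_iff.1 h3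
            have h7 := hj.diffRow_eq
            obtain ⟨-, h11, -⟩ := strip_of_agree hj h5 (h7 ▸ h6)
            have := (le_diffRow_iff h10).2 h9
            exact ⟨⟨h3, by omega⟩, h5, h6⟩
    refine ⟨fun _ => main, ?_⟩
    rw [main, chains_of_pos (Nat.add_one_pos n) hν]
    simp

open scoped Classical in
theorem card_descents_subset (S : Finset ℕ) {n : ℕ} {ν : YoungDiagram} (hν : ν.card = n) :
    Finset.card {T : StandardTableau ν | T.descents ⊆ S} = chains S n ν := by
  rw [← (tabCount_eq S n ν hν).2, tabCount]
  simp

/-! ### Counting vacillating tableaux -/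

theorem VacillatingTableau.ext_full_half {n r : ℕ} {μ : YoungDiagram}
    {Q Q' : VacillatingTableau n r μ} (h : Q.full = Q'.full) (h' : Q.half = Q'.half) :
    Q = Q' := by
  cases Q
  cases Q'
  simp only at h h'
  subst h
  subst h'
  rfl

/-- Extend a vacillating tableau by deleting and adding a box. -/
def VacillatingTableau.extend {n r : ℕ} {μ ρ ν : YoungDiagram} (Q : VacillatingTableau n r μ)
    (hμ : AddBox ρ μ) (hν : AddBox ρ ν) : VacillatingTableau n (r + 1) ν where
  full := Fin.snoc Q.full ν
  half := Fin.snoc Q.half ρ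
  full_zero := by
    rw [← Fin.castSucc_zero, Fin.snoc_castSucc, Q.full_zero]
  del_box := fun i => by
    refine Fin.lastCases ?_ (fun i => ?_) i
    · rw [Fin.snoc_last, Fin.snoc_castSucc, Q.full_last]
      exact hμ
    · rw [Fin.snoc_castSucc, Fin.snoc_castSucc]
      exact Q.del_box i
  add_box := fun i => by
    refine Fin.lastCases ?_ (fun i => ?_) i
    · rw [Fin.snoc_last, Fin.succ_last, Fin.snoc_last]
      exact hν
    · rw [Fin.snoc_castSucc, Fin.succ_castSucc, Fin.snoc_castSucc]
      exact Q.add_box i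
  full_last := Fin.snoc_last _ _

theorem extend_bijective (n r : ℕ) (ν : YoungDiagram) :
    Function.Bijective fun p : Σ ρ : down ν, Σ μ : up ρ.1, VacillatingTableau n r μ.1 =>
      p.2.2.extend (mem_up.1 p.2.1.2) (mem_down.1 p.1.2) := by
  constructor
  · rintro ⟨⟨ρ, hρ⟩, ⟨μ, hμ⟩, Q⟩ ⟨⟨ρ', hρ'⟩, ⟨μ', hμ'⟩, Q'⟩ h
    have h1 := congrArg VacillatingTableau.full h
    have h2 := congrArg VacillatingTableau.half h
    simp only [VacillatingTableau.extend] at h1 h2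
    have h3 : Q.full = Q'.full := by
      have := congrArg Fin.init h1
      rwa [Fin.init_snoc, Fin.init_snoc] at this
    have h4 : Q.half = Q'.half := by
      have := congrArg Fin.init h2
      rwa [Fin.init_snoc, Fin.init_snoc] at this
    obtain rfl : ρ = ρ' := by
      have := congrFun h2 (Fin.last r)
      rwa [Fin.snoc_last, Fin.snoc_last] at this
    obtain rfl : μ = μ' := by
      exact Q.full_last.symm.trans ((congrFun h3 _).trans Q'.full_last)
    rw [VacillatingTableau.ext_full_half h3 h4]
  · intro Q
    refine ⟨⟨⟨Q.half (Fin.last r), mem_down.2 (by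
        have := Q.add_box (Fin.last r)
        rwa [Fin.succ_last, Q.full_last] at this)⟩,
      ⟨Q.full (Fin.last r).castSucc, mem_up.2 (Q.del_box (Fin.last r))⟩,
      { full := fun i => Q.full i.castSucc
        half := fun i => Q.half i.castSucc
        full_zero := Q.full_zero
        del_box := fun i => Q.del_box i.castSucc
        add_box := fun i => Q.add_box i.castSucc
        full_last := rfl }⟩, ?_⟩
    refine VacillatingTableau.ext_full_half ?_ ?_
    · funext i
      refine Fin.lastCases ?_ (fun i => ?_) i
      · simp [VacillatingTableau.extend, Q.full_last]
      · simp [VacillatingTableau.extend]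
    · funext i
      refine Fin.lastCases ?_ (fun i => ?_) i <;> simp [VacillatingTableau.extend]

theorem numVac_succ (n r : ℕ) (ν : YoungDiagram) :
    numVac n (r + 1) ν = vac (numVac n r) ν := by
  rw [numVac, ← Fintype.card_of_bijective (extend_bijective n r ν), Fintype.card_sigma, vac,
    ← Finset.sum_coe_sort (down ν)]
  refine Finset.sum_congr rfl fun ρ _ => ?_
  rw [Fintype.card_sigma, ← Finset.sum_coe_sort (up ρ.1)]
  rfl

/-- `vac` is symmetric: a delete-add step read backwards is again a delete-add step. -/
theorem sum_numVac_succ_mul (n r : ℕ) (g : YoungDiagram → ℕ) :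
    ∑ ν ∈ parts n, numVac n (r + 1) ν * g ν = ∑ μ ∈ parts n, numVac n r μ * vac g μ := by
  simp only [numVac_succ, vac, Finset.sum_mul, Finset.mul_sum]
  have h : ∀ ν, ν ∈ parts n → ∀ ρ, AddBox ρ ν → ∀ μ, AddBox ρ μ → μ ∈ parts n := by
    intro ν hν ρ h1 μ h2
    rw [mem_parts] at hν ⊢
    have := h1.card_eq
    have := h2.card_eq
    omega
  simp only [Finset.sum_sigma']
  refine Finset.sum_bij' (fun p _ => ⟨p.2.2, p.2.1, p.1⟩) (fun p _ => ⟨p.2.2, p.2.1, p.1⟩)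
    ?_ ?_ ?_ ?_ ?_
  · rintro ⟨ν, ρ, μ⟩ hp
    simp only [Finset.mem_sigma, mem_down, mem_up] at hp ⊢
    exact ⟨h ν hp.1 ρ hp.2.1 μ hp.2.2, hp.2.2, hp.2.1⟩
  · rintro ⟨ν, ρ, μ⟩ hp
    simp only [Finset.mem_sigma, mem_down, mem_up] at hp ⊢
    exact ⟨h ν hp.1 ρ hp.2.1 μ hp.2.2, hp.2.2, hp.2.1⟩
  · intros; rfl
  · intros; rfl
  · intros; rfl

/-! ### Shapes reached from the one-row partition -/

theorem AddBox.rowLen_zero {μ ν : YoungDiagram} (h : AddBox μ ν) :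
    μ.rowLen 0 ≤ ν.rowLen 0 ∧ ν.rowLen 0 ≤ μ.rowLen 0 + 1 := by
  obtain ⟨i, hi⟩ := addBox_iff.1 h
  rcases Nat.eq_zero_or_pos i with rfl | h0
  · have := hi.1
    omega
  · have := hi.2 0 h0.ne
    omega

theorem mem_oneRow {n i j : ℕ} : (i, j) ∈ oneRow n ↔ i = 0 ∧ j < n := by
  rw [← YoungDiagram.mem_cells]
  simp [oneRow, and_comm, eq_comm]

theorem rowLen_oneRow_zero (n : ℕ) : (oneRow n).rowLen 0 = n := by
  have h : ∀ j, j < (oneRow n).rowLen 0 ↔ j < n := fun j => by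
    rw [← YoungDiagram.mem_iff_lt_rowLen, mem_oneRow]
    simp
  have h1 := h n
  have h2 := h ((oneRow n).rowLen 0)
  omega

/-- Each of the `r` rounds shortens the first row by at most one. -/
theorem VacillatingTableau.le_rowLen_zero {n r : ℕ} {ν : YoungDiagram}
    (Q : VacillatingTableau n r ν) : n ≤ ν.rowLen 0 + r := by
  have h : ∀ i : Fin (r + 1), n ≤ (Q.full i).rowLen 0 + i := by
    intro i
    induction i using Fin.induction with
    | zero => rw [Q.full_zero, rowLen_oneRow_zero]; omega
    | succ i ih =>
      have h1 := (Q.del_box i).rowLen_zero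
      have h2 := (Q.add_box i).rowLen_zero
      rw [Fin.val_castSucc] at ih
      rw [Fin.val_succ]
      omega
  have := h (Fin.last r)
  rwa [Q.full_last, Fin.val_last] at this

theorem sum_rowLens (μ : YoungDiagram) : μ.rowLens.sum = μ.card := by
  have h : μ.card = ∑ i ∈ Finset.range (μ.colLen 0), {c ∈ μ.cells | c.1 = i}.card := by
    refine Finset.card_eq_sum_card_fiberwise fun c hc => ?_
    rw [Finset.mem_coe, YoungDiagram.mem_cells] at hc
    rw [Finset.mem_coe, Finset.mem_range, ← YoungDiagram.mem_iff_lt_colLen]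
    exact μ.up_left_mem le_rfl (Nat.zero_le _) hc
  rw [h, YoungDiagram.rowLens, Finset.sum_range, ← List.sum_ofFn]
  congr 1
  apply List.ext_getElem
  · simp
  · intro i h1 h2
    simp only [List.getElem_map, List.getElem_range, List.getElem_ofFn]
    rw [YoungDiagram.rowLen_eq_card]
    rfl

theorem VacillatingTableau.mem_Lam {n r : ℕ} {ν : YoungDiagram} (Q : VacillatingTableau n r ν) :
    ν ∈ Lam n r := by
  have hcard : ν.card = n := by rw [← Q.full_last, Q.card_full]
  have h1 := Q.le_rowLen_zero
  have h2 := sum_rowLens ν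
  refine ⟨hcard, ?_⟩
  rcases Nat.eq_zero_or_pos (ν.colLen 0) with h0 | h0
  · simp [YoungDiagram.rowLens, h0]
  · obtain ⟨m, hm⟩ : ∃ m, ν.colLen 0 = m + 1 := ⟨ν.colLen 0 - 1, by omega⟩
    rw [YoungDiagram.rowLens, hm, List.range_succ_eq_map, List.map_cons] at h2 ⊢
    rw [List.sum_cons] at h2
    rw [List.tail_cons]
    omega

theorem numVac_eq_zero_of_notMem {n r : ℕ} {ν : YoungDiagram} (h : ν ∉ Lam n r) :
    numVac n r ν = 0 := by
  rw [numVac, Fintype.card_eq_zero_iff]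
  exact ⟨fun Q => h Q.mem_Lam⟩

open scoped Classical in
theorem numVac_zero (n : ℕ) (ν : YoungDiagram) :
    numVac n 0 ν = if ν = oneRow n then 1 else 0 := by
  rw [numVac]
  split_ifs with h
  · rw [Fintype.card_eq_one_iff]
    refine ⟨⟨fun _ => oneRow n, Fin.elim0, rfl, fun i => i.elim0, fun i => i.elim0, h.symm⟩,
      fun Q => VacillatingTableau.ext_full_half ?_ (funext fun i => i.elim0)⟩
    funext i
    rw [Fin.fin_one_eq_zero i]
    exact Q.full_zero
  · rw [Fintype.card_eq_zero_iff]
    refine ⟨fun Q => h ?_⟩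
    rw [← Q.full_last, ← Q.full_zero]
    rfl

/-- A diagram inside one row is determined by its size, so the chain is forced. -/
theorem chains_oneRow (S : Finset ℕ) (n : ℕ) : chains S n (oneRow n) = 1 := by
  induction n using Nat.strong_induction_on with
  | _ n ih =>
    rcases Nat.eq_zero_or_pos n with rfl | hn
    · exact chains_zero (card_oneRow 0)
    · have hlt := below_lt S hn
      rw [chains_of_pos hn (card_oneRow n), ← ih _ hlt]
      have hle : ∀ m k, m ≤ k → oneRow m ≤ oneRow k := by
        rintro m k hmk ⟨i, j⟩ h
        exact mem_oneRow.2 ⟨(mem_oneRow.1 h).1, (mem_oneRow.1 h).2.trans_le hmk⟩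
      have hzero : ∀ m i, (oneRow m).rowLen (i + 1) = 0 := by
        intro m i
        by_contra h
        have h1 := mem_oneRow.1 (YoungDiagram.mem_iff_lt_rowLen.2 (Nat.pos_of_ne_zero h))
        omega
      refine Finset.sum_eq_single_of_mem _ (mem_strips.2 fun i => ?_) fun μ hμ hne => ?_
      · exact ⟨le_iff_rowLen.1 (hle _ _ hlt.le) i, by rw [hzero]; exact Nat.zero_le _⟩
      · refine chains_of_card_ne fun hc => hne ?_
        refine eq_of_le_of_card_le ?_ (by rw [card_oneRow, hc])
        rintro ⟨i, j⟩ hij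
        have h0 := (mem_oneRow.1 ((mem_strips.1 hμ).le hij)).1
        subst h0
        refine mem_oneRow.2 ⟨rfl, ?_⟩
        have h1 := YoungDiagram.mem_iff_lt_rowLen.1 hij
        have h2 : μ.rowLen 0 ≤ μ.card := by
          rw [YoungDiagram.rowLen_eq_card]
          exact Finset.card_le_card (Finset.filter_subset _ _)
        omega

/-! ### The identity -/

theorem wordCount_eq (n r : ℕ) (S : Finset ℕ) :
    wordCount n r S = ∑ ν ∈ parts n, numVac n r ν * chains S n ν := by
  induction r generalizing S with
  | zero =>
    classical
    simp only [wordCount_zero, numVac_zero, ite_mul, one_mul, zero_mul]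
    rw [Finset.sum_ite_eq' _ (oneRow n), if_pos (mem_parts.2 (card_oneRow n)), chains_oneRow]
  | succ r ih =>
    rw [wordCount_succ, sum_numVac_succ_mul]
    simp only [ih, vac_chains, Finset.mul_sum]
    exact Finset.sum_comm

/-! ### From containment counts to equidistribution -/

theorem card_subset_eq_add {α γ : Type*} [Fintype α] [DecidableEq γ] (f : α → Finset γ)
    (S : Finset γ) :
    Finset.card {a | f a ⊆ S} =
      Finset.card {a | f a = S} + ∑ U ∈ S.ssubsets, Finset.card {a | f a = U} := by
  rw [Finset.card_eq_sum_card_fiberwise (f := f) (t := S.powerset)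
    (fun a ha => by simpa using ha), ← Finset.insert_erase (Finset.mem_powerset_self S),
    Finset.sum_insert (Finset.notMem_erase _ _)]
  congr 1
  · congr 1
    ext a
    simp only [Finset.mem_filter, Finset.mem_univ, true_and]
    exact ⟨fun h => h.2, fun h => ⟨h.subset, h⟩⟩
  · refine Finset.sum_congr rfl fun U hU => ?_
    congr 1
    ext a
    simp only [Finset.mem_filter, Finset.mem_univ, true_and]
    refine ⟨fun h => h.2, fun h => ⟨?_, h⟩⟩
    rw [h]
    exact (Finset.mem_ssubsets.1 hU).1

/-- Möbius inversion on finite subsets, done by strong induction: the contributions of proper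
subsets of `S` cancel. -/
theorem card_fiber_eq {α β γ : Type*} [Fintype α] [Fintype β] [DecidableEq γ]
    {f : α → Finset γ} {g : β → Finset γ}
    (h : ∀ S : Finset γ, Finset.card {a | f a ⊆ S} = Finset.card {b | g b ⊆ S}) (S : Finset γ) :
    Finset.card {a | f a = S} = Finset.card {b | g b = S} := by
  induction S using Finset.strongInduction with
  | _ S ih =>
    have h1 := h S
    rw [card_subset_eq_add f, card_subset_eq_add g, Finset.sum_congr rfl fun U hU => ih U (Finset.mem_ssubsets.1 hU)] at h1
    exact Nat.add_right_cancel h1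

theorem sum_comp_eq_of_card_subset_eq {α β γ R : Type*} [Fintype α] [Fintype β] [DecidableEq γ]
    [CommSemiring R] {f : α → Finset γ} {g : β → Finset γ}
    (h : ∀ S : Finset γ, Finset.card {a | f a ⊆ S} = Finset.card {b | g b ⊆ S})
    (w : Finset γ → R) : ∑ a, w (f a) = ∑ b, w (g b) := by
  have h' := card_fiber_eq h
  set I := Finset.univ.image f ∪ Finset.univ.image g with hI
  rw [← Finset.sum_fiberwise_of_maps_to (t := I) (g := f) (fun a _ => by simp [hI]),
    ← Finset.sum_fiberwise_of_maps_to (t := I) (g := g) (fun a _ => by simp [hI])]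
  refine Finset.sum_congr rfl fun S _ => ?_
  rw [Finset.sum_congr rfl fun a ha => by rw [(Finset.mem_filter.1 ha).2],
    Finset.sum_congr (s₁ := {b | g b = S}) rfl fun a ha => by rw [(Finset.mem_filter.1 ha).2],
    Finset.sum_const, Finset.sum_const, h']

open scoped Classical in
-- The sum over all partitions of `n` reduces to `Lam n r` because `numVac` vanishes elsewhere.
theorem card_pairs_descents_subset (n r : ℕ) (S : Finset ℕ) :
    Finset.card {p : Σ μ : Lam n r, StandardTableau μ.1 × VacillatingTableau n r μ.1 |
      p.2.1.descents ⊆ S} = ∑ ν ∈ parts n, numVac n r ν * chains S n ν := by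
  have h1 : ∑ ν ∈ parts n, numVac n r ν * chains S n ν =
      ∑ μ : Lam n r, numVac n r μ.1 * chains S n μ.1 := by
    rw [← Finset.sum_subtype ((parts n).filter (· ∈ Lam n r)) (p := (· ∈ Lam n r))
      (fun μ => by
        rw [Finset.mem_filter, mem_parts]
        exact ⟨fun h => h.2, fun h => ⟨h.1, h⟩⟩) (fun ν => numVac n r ν * chains S n ν)]
    symm
    refine Finset.sum_subset (Finset.filter_subset _ _) fun ν hν hν' => ?_
    rw [numVac_eq_zero_of_notMem, zero_mul]
    intro h
    exact hν' (Finset.mem_filter.2 ⟨hν, h⟩)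
  rw [h1, Finset.card_filter, Fintype.sum_sigma]
  refine Finset.sum_congr rfl fun μ _ => ?_
  rw [Fintype.sum_prod_type, ← card_descents_subset S μ.2.1, Finset.card_filter, Finset.mul_sum]
  refine Finset.sum_congr rfl fun T _ => ?_
  by_cases h : T.descents ⊆ S <;> simp [h, numVac]

end QPart

theorem mainTheorem3 (n r : ℕ) (hn : 0 < n) (hr : 0 < r) :
    (∑ a : Fin r → Fin n, (X : ℤ[X]) ^ QPart.imaj (QPart.wordPerm a) =
      ∑ μ : QPart.Lam n r,
        ∑ PQ : QPart.StandardTableau μ.1 × QPart.VacillatingTableau n r μ.1,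
          (X : ℤ[X]) ^ PQ.1.maj) ∧
    (∑ μ : QPart.Lam n r,
        ∑ PQ : QPart.StandardTableau μ.1 × QPart.VacillatingTableau n r μ.1,
          (X : ℤ[X]) ^ PQ.1.maj =
      ∑ μ : QPart.Lam n r, QPart.fq μ.1 * (QPart.numVac n r μ.1 : ℤ[X])) := by
  constructor
  · rw [← Fintype.sum_sigma' (fun μ : QPart.Lam n r => fun PQ :
      QPart.StandardTableau μ.1 × QPart.VacillatingTableau n r μ.1 => (X : ℤ[X]) ^ PQ.1.maj)]
    refine QPart.sum_comp_eq_of_card_subset_eq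
      (f := fun a : Fin r → Fin n => QPart.backsteps (QPart.wordPerm a))
      (g := fun p : Σ μ : QPart.Lam n r,
        QPart.StandardTableau μ.1 × QPart.VacillatingTableau n r μ.1 => p.2.1.descents)
      (fun S => ?_) (fun S => (X : ℤ[X]) ^ ∑ i ∈ S, i)
    have h1 := QPart.wordCount_eq n r S
    have h2 := QPart.card_pairs_descents_subset n r S
    rw [← h2, QPart.wordCount] at h1
    convert h1 using 2
  · refine Finset.sum_congr rfl fun μ _ => ?_
    rw [Fintype.sum_prod_type, QPart.fq, Finset.sum_mul]
    refine Finset.sum_congr rfl fun T _ => ?_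
    simp [QPart.numVac, mul_comm]
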